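/- Let $\mathbb T$ be the unit circle, $\mathbb D$ the open unit disc, and $|A|$ the arc length measure of $A\subset\mathbb T$. For an analytic function $f$ on $\mathbb D$ write $f^*(\zeta)=\lim_{r\to1^-}f(r\zeta)$ wherever this radial limit exists; for $f$ in the Hardy space $\mathrm H^2$ it exists at almost every $\zeta\in\mathbb T$. For open arcs $I\subset\mathbb T$ (and for $I=\mathbb T$), $0<\alpha\le1$ and $f\in\mathrm H^2$ put $$\mathcal D_{I,\alpha}(f)=\int_I\int_I\frac{|f^*(z)-f^*(w)|^2}{|z-w|^{1+\alpha}}\,\frac{|dz|}{2\pi}\,\frac{|dw|}{2\pi},$$ and let $\mathcal D_\alpha$ be the space of all $f\in\mathrm H^2$ with $\mathcal D_{\mathbb T,\alpha}(f)<\infty$. For $0<\beta\le 1$ and an arbitrary set $A\subset\mathbb T$ let $$C_{\beta,2}(A)=\inf\Big\{\int_{\mathbb T}g^2\,\frac{|d\xi|}{2\pi}\ :\ g\in L^2(\mathbb T),\ g\ge0,\ \int_{\mathbb T}\frac{g(\xi)}{|\zeta-\xi|^{1-\beta/2}}\,\frac{|d\xi|}{2\pi}\ge1\ \text{ for every }\zeta\in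 A\Big\}.$$ **Theorem.** Let $0<\beta\le1$ and $0<\gamma<1$. There is a constant $c>0$, depending only on $\beta$ and $\gamma$, such that for every $\alpha$ with $\beta\le\alpha\le1$, every $f\in\mathcal D_\alpha$, every set $E\subset\mathbb T$ such that $f^*(\zeta)$ exists and equals $0$ for every $\zeta\in E$, and every (nonempty) open arc $I\subset\mathbb T$ with $|I|\le\gamma\pi$, $$\Big[\frac1{|I|}\int_I|f^*(\xi)|\,|d\xi|\Big]^2\,C_{\beta,2}(E\cap I)\ \le\ c\,|I|^{\alpha-\beta}\,\mathcal D_{I,\alpha}(f).$$ Equivalently, whenever $C_{\beta,2}(E\cap I)>0$, $$\Big[\frac1{|I|}\int_I|f^*(\xi)|\,|d\xi|\Big]^2\ \le\ \frac{c\,|I|^{\alpha-\beta}}{C_{\beta,2}(E\cap I)}\,\mathcal D_{I,\alpha}(f).$$ -/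

import Mathlib

open Set Filter Topology MeasureTheory
open scoped ENNReal NNReal

noncomputable section

/-- The unit circle carries its Borel σ-algebra. -/
instance circleMeasurableSpace : MeasurableSpace Circle := borel Circle

instance circleBorelSpace : BorelSpace Circle := ⟨rfl⟩

/-- Arc length `|dz|` on the unit circle: the image of Lebesgue measure on `(-π, π]` under
`t ↦ exp (i t)`. Its total mass is `2π`. -/
def arcLength : Measure Circle :=
  Measure.map Circle.exp (volume.restrict (Ioc (-Real.pi) Real.pi))

/-- Normalized arc length `|dz| / (2π)` on the unit circle. -/
def normArcLength : Measure Circle :=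
  ENNReal.ofReal (2 * Real.pi)⁻¹ • arcLength

/-- An open arc of the unit circle: the image of a nonempty bounded open interval of angles. -/
def IsOpenArc (I : Set Circle) : Prop :=
  ∃ a b : ℝ, a < b ∧ I = Circle.exp '' Ioo a b

/-- `f` has the radial limit `l` at the boundary point `ζ`: `f (r ζ) → l` as `r → 1-`. -/
def HasRadialLimit (f : ℂ → ℂ) (ζ : Circle) (l : ℂ) : Prop :=
  Tendsto (fun r : ℝ => f ((r : ℂ) * (ζ : ℂ))) (𝓝[<] (1 : ℝ)) (𝓝 l)

/-- The boundary function `f*`, the radial limit of `f`. It is meaningful at the points where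
the radial limit exists, which for `f` in the Hardy space is almost every point. -/
def boundaryValue (f : ℂ → ℂ) (ζ : Circle) : ℂ :=
  limUnder (𝓝[<] (1 : ℝ)) (fun r : ℝ => f ((r : ℂ) * (ζ : ℂ)))

/-- The Dirichlet-type (Douglas) integral of a function `u` on the circle over `I × J`:
`∫_I ∫_J |u z - u w|² / |z - w| ^ (1 + α) |dz|/(2π) |dw|/(2π)`. -/
def dirichletIntegral (α : ℝ) (I J : Set Circle) (u : Circle → ℂ) : ℝ≥0∞ :=
  ∫⁻ z in I, ∫⁻ w in J,
    ENNReal.ofReal (‖u z - u w‖ ^ 2 / ‖(z : ℂ) - (w : ℂ)‖ ^ (1 + α)) ∂normArcLength ∂normArcLength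

/-- The Hardy space `H²` of the unit disc: analytic functions with bounded quadratic means over
the circles of radius `r < 1`. -/
structure MemHardyTwo (f : ℂ → ℂ) : Prop where
  differentiableOn : DifferentiableOn ℂ f (Metric.ball 0 1)
  bounded_means : ∃ M : ℝ≥0, ∀ r : ℝ, 0 ≤ r → r < 1 →
    ∫⁻ ζ : Circle, ‖f ((r : ℂ) * (ζ : ℂ))‖ₑ ^ 2 ∂normArcLength ≤ M

/-- The Dirichlet space `𝒟_α`: the functions of `H²` whose boundary function has a finite
Dirichlet-type integral over the whole circle. -/
structure MemDirichlet (α : ℝ) (f : ℂ → ℂ) : Prop where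
  memHardyTwo : MemHardyTwo f
  energy_lt_top : dirichletIntegral α univ univ (boundaryValue f) < ∞

/-- The kernel `k_s ζ = |1 - ζ| ^ (-s)` on the circle, for `0 < s < 1` (with value `∞` at `1`). -/
def circleKernel (s : ℝ) (ζ : Circle) : ℝ≥0∞ :=
  ENNReal.ofReal ‖1 - (ζ : ℂ)‖ ^ (-s)

/-- The potential `k_s ⋆ g` of a nonnegative function `g` on the circle. On the circle `ξ⁻¹` is
the complex conjugate of `ξ`. -/
def circlePotential (s : ℝ) (g : Circle → ℝ≥0) (ζ : Circle) : ℝ≥0∞ :=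
  ∫⁻ ξ : Circle, circleKernel s (ζ * ξ⁻¹) * (g ξ : ℝ≥0∞) ∂normArcLength

/-- The `L²`-capacity `C_{β,2}(E)` of an arbitrary set `E` in the circle: the infimum of `‖g‖²`
over the nonnegative `g ∈ L²` with `k_{1 - β/2} ⋆ g ≥ 1` at every point of `E`. (Functions `g` that
are not square integrable contribute `∞`, so they do not change the infimum.) -/
def ltwoCapacity (β : ℝ) (E : Set Circle) : ℝ≥0∞ :=
  ⨅ (g : Circle → ℝ≥0) (_ : Measurable g)
    (_ : ∀ ζ ∈ E, 1 ≤ circlePotential (1 - β / 2) g ζ),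
    ∫⁻ ξ : Circle, (g ξ : ℝ≥0∞) ^ 2 ∂normArcLength

end

/-! A function of H² is the Poisson integral of some F in L², and by Fatou's theorem f* = F almost
everywhere, so the integrals may be computed with F. The capacity needs a bound at every point of E
∩ I, and there the radial limit of f itself is used.

Fix ζ in E ∩ I. Restrict the Poisson kernel of ρζ to I and normalize it. The part off I is
negligible as ρ → 1, so the means of F against these probability measures tend to 0. Along 1 - ρ =
δ/4^j with δ comparable to |I|, telescoping bounds the mean of |F| over I by the sum of the
oscillations of F at all scales (`lintegral_enorm_le_tsum_oscillation`). Working with kernels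
restricted to I avoids any extension of F beyond the arc.

Let G(z) be the inner integral of the order β Dirichlet integral over I (`energyDensity`).
Cauchy–Schwarz bounds each oscillation by the integral over I of G^(1/2) against an explicit
profile, and the profiles sum over j to at most a multiple of |ζ - z|^(-(1 - β/2))
(`tsum_oscillation_localCauchy_le`). Hence the mean of |F| is at most a constant times the potential
of G^(1/2) 1_I at ζ (`average_le_potential_energyDensity`). A multiple of G^(1/2) 1_I is thus
admissible for the capacity, and the square of its L² norm is a multiple of the order β energy on I.
Since chords in I are at most |I|, this energy is at most |I|^(α - β) times that of order α. -/

/-! ### Arc length and chordal distance on the circle -/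

theorem arcLength_eq_map_Ioc (a : ℝ) :
    arcLength = Measure.map Circle.exp (volume.restrict (Ioc a (a + 2 * Real.pi))) := by
  have : Fact (0 < 2 * Real.pi) := ⟨Real.two_pi_pos⟩
  -- Every interval of length 2π is a fundamental domain for ℝ/2πℤ, so each choice pushes forward
  -- the same measure.
  have key (t : ℝ) : Measure.map Circle.exp (volume.restrict (Ioc t (t + 2 * Real.pi))) =
      Measure.map (AddCircle.toCircle (T := 2 * Real.pi)) volume := by
    rw [← (AddCircle.measurePreserving_mk (2 * Real.pi) t).map_eq,
      Measure.map_map AddCircle.continuous_toCircle.measurable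
        (AddCircle.measurePreserving_mk (2 * Real.pi) t).measurable]
    congr 1
    ext x
    simp [AddCircle.toCircle_apply_mk]
  rw [key a, ← key (-Real.pi), arcLength]
  congr 3
  ring

theorem arcLength_apply {s : Set Circle} (hs : MeasurableSet s) (a : ℝ) :
    arcLength s = volume (Circle.exp ⁻¹' s ∩ Ioc a (a + 2 * Real.pi)) := by
  rw [arcLength_eq_map_Ioc a, Measure.map_apply Circle.exp.continuous.measurable hs,
    Measure.restrict_apply (Circle.exp.continuous.measurable hs)]

theorem isOpen_circleExp_image_Ioo (a b : ℝ) : IsOpen (Circle.exp '' Ioo a b) :=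
  isLocalHomeomorph_circleExp.isOpenMap _ isOpen_Ioo

theorem le_arcLength_circleExp_image {s : Set ℝ} (hs : IsOpen s) {a : ℝ}
    (hsub : s ⊆ Ioc a (a + 2 * Real.pi)) : volume s ≤ arcLength (Circle.exp '' s) := by
  rw [arcLength_apply (isLocalHomeomorph_circleExp.isOpenMap _ hs).measurableSet a]
  exact measure_mono (subset_inter (subset_preimage_image _ _) hsub)

theorem arcLength_circleExp_image_Ioo {a b : ℝ} (h : b - a ≤ 2 * Real.pi) :
    arcLength (Circle.exp '' Ioo a b) = ENNReal.ofReal (b - a) := by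
  apply le_antisymm
  · rw [arcLength_apply (isOpen_circleExp_image_Ioo a b).measurableSet a, ← Real.volume_Ioo]
    have hinj := Circle.exp_injOn_Ioc (a := a) (b := a + 2 * Real.pi) (by linarith)
    refine measure_mono ?_
    rintro x ⟨⟨y, hy, hxy⟩, hx⟩
    rwa [← hinj ⟨hy.1, by linarith [hy.2]⟩ hx hxy]
  · rw [← Real.volume_Ioo]
    exact le_arcLength_circleExp_image isOpen_Ioo
      (Ioo_subset_Ioc_self.trans (Ioc_subset_Ioc_right (by linarith)))

theorem arcLength_univ : arcLength univ = ENNReal.ofReal (2 * Real.pi) := by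
  rw [arcLength_apply MeasurableSet.univ 0]
  simp

theorem normArcLength_apply (s : Set Circle) :
    normArcLength s = ENNReal.ofReal (2 * Real.pi)⁻¹ * arcLength s := by
  simp [normArcLength]

instance : IsProbabilityMeasure normArcLength := by
  constructor
  rw [normArcLength_apply, arcLength_univ, ← ENNReal.ofReal_mul (by positivity),
    inv_mul_cancel₀ (by positivity), ENNReal.ofReal_one]

theorem dist_circleExp_eq (s t : ℝ) :
    dist (Circle.exp s) (Circle.exp t) = |2 * Real.sin ((s - t) / 2)| := by
  have h : ((Circle.exp s : Circle) : ℂ) - Circle.exp t =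
      Circle.exp t * (Complex.exp (Complex.I * ((s - t : ℝ) : ℂ)) - 1) := by
    rw [Circle.coe_exp, Circle.coe_exp, mul_sub, ← Complex.exp_add]
    push_cast
    ring_nf
  change dist ((Circle.exp s : Circle) : ℂ) (Circle.exp t : Circle) = _
  rw [dist_eq_norm, h, norm_mul, Circle.norm_coe, one_mul,
    Complex.norm_exp_I_mul_ofReal_sub_one, Real.norm_eq_abs]

theorem dist_circleExp_le (s t : ℝ) : dist (Circle.exp s) (Circle.exp t) ≤ |s - t| := by
  rw [dist_circleExp_eq, abs_mul, abs_two]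
  have := Real.abs_sin_le_abs (x := (s - t) / 2)
  rw [abs_div, abs_two] at this
  linarith

/-- Jordan's inequality for the sine; π/2 is the ratio of arc to chord at antipodal points. -/
theorem abs_sub_le_dist_circleExp {s t : ℝ} (h : |s - t| ≤ Real.pi) :
    |s - t| ≤ Real.pi / 2 * dist (Circle.exp s) (Circle.exp t) := by
  rw [dist_circleExp_eq, abs_mul, abs_two]
  have h2 : |(s - t) / 2| = |s - t| / 2 := by rw [abs_div, abs_two]
  have := Real.mul_abs_le_abs_sin (x := (s - t) / 2) (by rw [h2]; linarith)
  rw [h2, div_mul_eq_mul_div, div_le_iff₀ Real.pi_pos] at this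
  nlinarith

theorem normArcLength_closedBall_le (z : Circle) (h : ℝ) :
    normArcLength (Metric.closedBall z h) ≤ ENNReal.ofReal (h / 2) := by
  obtain ⟨t, rfl⟩ : ∃ t, Circle.exp t = z := ⟨_, Circle.exp_arg z⟩
  have hsub : Circle.exp ⁻¹' Metric.closedBall (Circle.exp t) h ∩
      Ioc (t - Real.pi) (t - Real.pi + 2 * Real.pi) ⊆
      Icc (t - Real.pi / 2 * h) (t + Real.pi / 2 * h) := by
    rintro s ⟨hs, h1, h2⟩
    rw [mem_preimage, Metric.mem_closedBall] at hs
    have h3 : |s - t| ≤ Real.pi / 2 * dist (Circle.exp s) (Circle.exp t) :=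
      abs_sub_le_dist_circleExp (abs_le.2 ⟨by linarith, by linarith⟩)
    have h4 : |s - t| ≤ Real.pi / 2 * h :=
      h3.trans (mul_le_mul_of_nonneg_left hs (by positivity))
    have := abs_le.1 h4
    constructor <;> linarith
  rw [normArcLength_apply, arcLength_apply Metric.isClosed_closedBall.measurableSet (t - Real.pi)]
  calc _ ≤ ENNReal.ofReal (2 * Real.pi)⁻¹ *
        volume (Icc (t - Real.pi / 2 * h) (t + Real.pi / 2 * h)) := by gcongr
    _ = ENNReal.ofReal (h / 2) := by
      rw [Real.volume_Icc, ← ENNReal.ofReal_mul (by positivity)]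
      congr 1
      field_simp
      ring

theorem le_normArcLength_closedBall (z : Circle) {h : ℝ} (hh : h ≤ Real.pi) :
    ENNReal.ofReal (h / Real.pi) ≤ normArcLength (Metric.closedBall z h) := by
  obtain ⟨t, rfl⟩ : ∃ t, Circle.exp t = z := ⟨_, Circle.exp_arg z⟩
  have hsub : Circle.exp '' Ioo (t - h) (t + h) ⊆ Metric.closedBall (Circle.exp t) h := by
    rintro _ ⟨s, hs, rfl⟩
    exact (dist_circleExp_le s t).trans (abs_le.2 ⟨by linarith [hs.1], by linarith [hs.2]⟩)
  calc ENNReal.ofReal (h / Real.pi) = ENNReal.ofReal (2 * Real.pi)⁻¹ *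
        arcLength (Circle.exp '' Ioo (t - h) (t + h)) := by
        rw [arcLength_circleExp_image_Ioo (by linarith), ← ENNReal.ofReal_mul (by positivity)]
        congr 1
        field_simp
        ring
    _ ≤ _ := by
        rw [← normArcLength_apply]
        exact measure_mono hsub

/-- Small balls of radius h have measure between h/π and h/2, so doubling the radius costs at most π
≤ 4. Doubling supplies the Lebesgue points behind Fatou's theorem. -/
instance : IsUnifLocDoublingMeasure normArcLength := by
  refine ⟨4, ?_⟩
  have : ∀ᶠ ε : ℝ in 𝓝[>] 0, ε ∈ Ioo (0 : ℝ) 1 := Ioo_mem_nhdsGT one_pos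
  filter_upwards [this] with ε hε x
  have h3 := Real.pi_gt_three
  have h4 := Real.pi_le_four
  calc _ ≤ ENNReal.ofReal (2 * ε / 2) := normArcLength_closedBall_le x _
    _ ≤ ENNReal.ofReal (4 * (ε / Real.pi)) := by
        apply ENNReal.ofReal_le_ofReal
        rw [← mul_div_assoc, le_div_iff₀ Real.pi_pos]
        nlinarith [hε.1]
    _ = 4 * ENNReal.ofReal (ε / Real.pi) := by
        rw [ENNReal.ofReal_mul (by norm_num)]
        norm_num
    _ ≤ _ := by
        exact mul_le_mul' (by norm_num) (le_normArcLength_closedBall x (by linarith [hε.2]))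

/-! ### Poisson representation of functions in H² -/

theorem circleAverage_eq_integral_normArcLength {g : ℂ → ℂ}
    (hg : Continuous fun z : Circle => g z) :
    Real.circleAverage g 0 1 = ∫ z : Circle, g z ∂normArcLength := by
  rw [normArcLength, integral_smul_measure, arcLength_eq_map_Ioc 0,
    integral_map Circle.exp.continuous.measurable.aemeasurable
      hg.aestronglyMeasurable, Real.circleAverage_def, ENNReal.toReal_ofReal (by positivity),
    intervalIntegral.integral_of_le Real.two_pi_pos.le, zero_add]
  simp [circleMap, Circle.coe_exp]

theorem continuous_poissonKernel_circle {w : ℂ} (hw : w ∈ Metric.ball (0 : ℂ) 1) :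
    Continuous fun ξ : Circle => poissonKernel 0 w ξ := by
  unfold poissonKernel
  refine Continuous.div (by fun_prop) (by fun_prop) fun ξ => ?_
  have h1 : ‖w‖ < 1 := by simpa using hw
  have h2 : (ξ : ℂ) ≠ w := by
    intro h
    rw [← h, Circle.norm_coe] at h1
    exact lt_irrefl _ h1
  simpa [sub_eq_zero] using h2

/-- A dilate of f is continuous up to the boundary of the disc, so the classical Poisson formula
applies to it. -/
theorem integral_poissonKernel_mul_dilate {f : ℂ → ℂ}
    (hf : DifferentiableOn ℂ f (Metric.ball 0 1)) {w : ℂ} (hw : w ∈ Metric.ball (0 : ℂ) 1)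
    {r : ℝ} (hr : r ∈ Ico (0 : ℝ) 1) :
    ∫ ξ : Circle, (poissonKernel 0 w ξ : ℂ) * f (r * ξ) ∂normArcLength = f (r * w) := by
  have hmaps : MapsTo (fun z : ℂ => (r : ℂ) * z) (Metric.closedBall 0 1) (Metric.ball 0 1) := by
    intro z hz
    rw [mem_closedBall_zero_iff] at hz
    rw [mem_ball_zero_iff, norm_mul, Complex.norm_real, Real.norm_eq_abs, abs_of_nonneg hr.1]
    nlinarith [hr.1, hr.2]
  have hd : DifferentiableOn ℂ (fun z => f (r * z)) (Metric.closedBall 0 1) :=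
    hf.comp (by fun_prop) hmaps
  have hcont : Continuous fun ξ : Circle => f (r * ξ) := by
    refine hd.continuousOn.comp_continuous (f := fun ξ : Circle => (ξ : ℂ)) (by fun_prop) fun ξ => ?_
    simp [Circle.norm_coe]
  have hdc : DiffContOnCl ℂ (fun z => f (r * z)) (Metric.ball 0 1) := by
    refine ⟨hd.mono Metric.ball_subset_closedBall, ?_⟩
    rw [closure_ball _ one_ne_zero]
    exact hd.continuousOn
  have := hdc.circleAverage_poissonKernel_smul hw
  rw [circleAverage_eq_integral_normArcLength] at this
  · rw [← this]
    simp
  · exact (Complex.continuous_ofReal.comp (continuous_poissonKernel_circle hw)).mul hcont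

theorem integral_poissonKernel {w : ℂ} (hw : w ∈ Metric.ball (0 : ℂ) 1) :
    ∫ ξ : Circle, poissonKernel 0 w ξ ∂normArcLength = 1 := by
  have := integral_poissonKernel_mul_dilate (f := fun _ => 1) (by fun_prop) hw
    (r := 0) ⟨le_rfl, one_pos⟩
  simp only [mul_one] at this
  exact_mod_cast this

theorem MemHardyTwo.continuous_dilate {f : ℂ → ℂ} (hf : MemHardyTwo f) {r : ℝ}
    (hr : r ∈ Ico (0 : ℝ) 1) : Continuous fun ξ : Circle => f (r * ξ) := by
  refine hf.differentiableOn.continuousOn.comp_continuous (by fun_prop) fun ξ => ?_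
  simpa [abs_of_nonneg hr.1, Circle.norm_coe] using hr.2

/-- Bounded families in a Hilbert space converge weakly along ultrafilters. -/
theorem exists_tendsto_inner_of_norm_le {𝕜 H ι : Type*} [RCLike 𝕜] [NormedAddCommGroup H]
    [InnerProductSpace 𝕜 H] [CompleteSpace H] (U : Ultrafilter ι) {u : ι → H} {B : ℝ}
    (hu : ∀ i, ‖u i‖ ≤ B) :
    ∃ v : H, ∀ g : H, Tendsto (fun i => inner 𝕜 (u i) g) U (𝓝 (inner 𝕜 v g)) := by
  let L : ι → WeakDual 𝕜 H := fun i => StrongDual.toWeakDual (InnerProductSpace.toDual 𝕜 H (u i))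
  have hcomp := WeakDual.isCompact_closedBall (𝕜 := 𝕜) (E := H) 0 B
  have hmem : ∀ i, L i ∈ WeakDual.toStrongDual ⁻¹' Metric.closedBall (0 : StrongDual 𝕜 H) B := by
    intro i
    change InnerProductSpace.toDual 𝕜 H (u i) ∈ Metric.closedBall 0 B
    rw [mem_closedBall_zero_iff, LinearIsometryEquiv.norm_map]
    exact hu i
  obtain ⟨Λ, -, hΛ⟩ := hcomp.ultrafilter_le_nhds' (U.map L)
    (Ultrafilter.mem_map.2 (Filter.Eventually.of_forall hmem))
  have hΛ' : Tendsto L U (𝓝 Λ) := hΛ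
  refine ⟨(InnerProductSpace.toDual 𝕜 H).symm (WeakDual.toStrongDual Λ), fun g => ?_⟩
  have h1 : Tendsto (fun i => L i g) U (𝓝 (Λ g)) :=
    ((WeakDual.eval_continuous g).tendsto Λ).comp hΛ'
  rw [InnerProductSpace.toDual_symm_apply]
  exact h1

/-- A function of `H²` is the Poisson integral of a square integrable function. -/
theorem MemHardyTwo.exists_poisson_representation {f : ℂ → ℂ} (hf : MemHardyTwo f) :
    ∃ F : Circle → ℂ, StronglyMeasurable F ∧ MemLp F 2 normArcLength ∧
      ∀ w ∈ Metric.ball (0 : ℂ) 1,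
        f w = ∫ ξ : Circle, (poissonKernel 0 w ξ : ℂ) * F ξ ∂normArcLength := by
  obtain ⟨M, hM⟩ := hf.bounded_means
  -- The dilates are conjugated because the inner product is conjugate linear in its first argument.
  -- The value 0 for r outside [0, 1) is a filler: the ultrafilter below concentrates near 1.
  have hex (r : ℝ) : ∃ u : Lp ℂ 2 normArcLength, ‖u‖ ≤ (M : ℝ) ^ (1 / 2 : ℝ) ∧
      (r ∈ Ico (0 : ℝ) 1 → u =ᵐ[normArcLength] fun ξ => star (f (r * ξ))) := by
    by_cases hr : r ∈ Ico (0 : ℝ) 1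
    · have hc : Continuous fun ξ : Circle => star (f (r * ξ)) :=
        continuous_star.comp (hf.continuous_dilate hr)
      have hle : eLpNorm (fun ξ : Circle => star (f (r * ξ))) 2 normArcLength ≤
          (M : ℝ≥0∞) ^ (1 / 2 : ℝ) := by
        rw [eLpNorm_eq_lintegral_rpow_enorm_toReal two_ne_zero ENNReal.ofNat_ne_top]
        simp only [ENNReal.toReal_ofNat]
        gcongr
        convert hM r hr.1 hr.2 using 4 with ξ
        simp [enorm_eq_nnnorm]
      have hlt : (M : ℝ≥0∞) ^ (1 / 2 : ℝ) < ∞ :=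
        ENNReal.rpow_lt_top_of_nonneg (by norm_num) ENNReal.coe_ne_top
      have hmem : MemLp (fun ξ : Circle => star (f (r * ξ))) 2 normArcLength :=
        ⟨hc.aestronglyMeasurable, hle.trans_lt hlt⟩
      refine ⟨hmem.toLp _, ?_, fun _ => hmem.coeFn_toLp⟩
      rw [Lp.norm_toLp]
      refine (ENNReal.toReal_mono hlt.ne hle).trans_eq ?_
      rw [← ENNReal.toReal_rpow, ENNReal.coe_toReal]
    · exact ⟨0, by simp; positivity, fun h => absurd h hr⟩
  choose u hu_norm hu using hex
  let U : Ultrafilter ℝ := Ultrafilter.of (𝓝[<] (1 : ℝ))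
  have hU : (U : Filter ℝ) ≤ 𝓝[<] (1 : ℝ) := Ultrafilter.of_le _
  obtain ⟨v, hv_lim⟩ := exists_tendsto_inner_of_norm_le (𝕜 := ℂ) U hu_norm
  have hv : StronglyMeasurable v := Lp.stronglyMeasurable v
  refine ⟨fun ξ => star (v ξ), continuous_star.comp_stronglyMeasurable hv,
    (Lp.memLp v).star, fun w hw => ?_⟩
  have hP : MemLp (fun ξ : Circle => (poissonKernel 0 w ξ : ℂ)) 2 normArcLength :=
    (Complex.continuous_ofReal.comp (continuous_poissonKernel_circle hw)).memLp_of_hasCompactSupport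
      (HasCompactSupport.of_compactSpace _)
  have h1 := hv_lim (hP.toLp _)
  have h2 : inner ℂ v (hP.toLp _) =
      ∫ ξ : Circle, (poissonKernel 0 w ξ : ℂ) * star (v ξ) ∂normArcLength := by
    rw [L2.inner_def]
    refine integral_congr_ae ?_
    filter_upwards [hP.coeFn_toLp] with ξ hξ
    rw [hξ]
    simp
  have hnear : ∀ᶠ r : ℝ in U, r ∈ Ico (0 : ℝ) 1 :=
    hU (Ico_mem_nhdsLT zero_lt_one)
  have h3 : ∀ᶠ r : ℝ in U, inner ℂ (u r) (hP.toLp _) = f (r * w) := by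
    filter_upwards [hnear] with r hr
    rw [← integral_poissonKernel_mul_dilate hf.differentiableOn hw hr]
    rw [L2.inner_def]
    refine integral_congr_ae ?_
    filter_upwards [hP.coeFn_toLp, hu r hr] with ξ hξ hξ'
    rw [hξ, hξ']
    simp
  have h4 : Tendsto (fun r : ℝ => f (r * w)) U (𝓝 (f w)) := by
    have hc : ContinuousAt f w :=
      (hf.differentiableOn.differentiableAt (Metric.isOpen_ball.mem_nhds hw)).continuousAt
    have : Tendsto (fun r : ℝ => (r : ℂ) * w) U (𝓝 w) := by
      have h0 : Tendsto (fun r : ℝ => (r : ℂ) * w) (𝓝 1) (𝓝 (((1 : ℝ) : ℂ) * w)) :=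
        Continuous.tendsto (by fun_prop) 1
      rw [Complex.ofReal_one, one_mul] at h0
      exact h0.mono_left (hU.trans nhdsWithin_le_nhds)
    exact hc.tendsto.comp this
  exact (tendsto_nhds_unique (h1.congr' h3) h4).symm.trans h2

/-! ### Comparison kernels and Fatou's theorem -/

/-- The kernel `δ / (δ² + x²)`, which is comparable to the Poisson kernel at height `δ`. -/
noncomputable def cauchyKernel (δ x : ℝ) : ℝ := δ / (δ ^ 2 + x ^ 2)

theorem cauchyKernel_nonneg {δ : ℝ} (hδ : 0 < δ) (x : ℝ) : 0 ≤ cauchyKernel δ x := by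
  unfold cauchyKernel
  positivity

theorem continuous_cauchyKernel {δ : ℝ} (hδ : 0 < δ) : Continuous (cauchyKernel δ) := by
  unfold cauchyKernel
  exact Continuous.div (by fun_prop) (by fun_prop) fun x => by positivity

theorem norm_sub_mul_sq (z w : Circle) (ρ : ℝ) :
    ‖(w : ℂ) - ρ * z‖ ^ 2 = (1 - ρ) ^ 2 + ρ * dist z w ^ 2 := by
  have hd : dist z w = ‖(z : ℂ) - w‖ := dist_eq_norm (z : ℂ) (w : ℂ)
  have hz : (z : ℂ).re ^ 2 + (z : ℂ).im ^ 2 = 1 := by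
    have := Circle.normSq_coe z
    rw [Complex.normSq_apply] at this
    nlinarith
  have hw : (w : ℂ).re ^ 2 + (w : ℂ).im ^ 2 = 1 := by
    have := Circle.normSq_coe w
    rw [Complex.normSq_apply] at this
    nlinarith
  rw [hd, ← Complex.normSq_eq_norm_sq, ← Complex.normSq_eq_norm_sq, Complex.normSq_apply,
    Complex.normSq_apply]
  simp only [Complex.sub_re, Complex.sub_im, Complex.re_ofReal_mul, Complex.im_ofReal_mul]
  linear_combination (1 - ρ) * hw + (ρ ^ 2 - ρ) * hz

theorem poissonKernel_radial (z w : Circle) {ρ : ℝ} :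
    poissonKernel 0 (ρ * z) w = (1 - ρ ^ 2) / ((1 - ρ) ^ 2 + ρ * dist z w ^ 2) := by
  rw [poissonKernel_def, sub_zero, sub_zero, norm_sub_mul_sq, Circle.norm_coe, norm_mul,
    Circle.norm_coe, Complex.norm_real, mul_one, Real.norm_eq_abs, sq_abs, one_pow]

theorem cauchyKernel_le_poissonKernel (z w : Circle) {ρ : ℝ} (hρ : ρ ∈ Ico (0 : ℝ) 1) :
    cauchyKernel (1 - ρ) (dist z w) ≤ poissonKernel 0 (ρ * z) w := by
  obtain ⟨h0, h1⟩ := hρ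
  rw [poissonKernel_radial, cauchyKernel]
  have h2 : 0 < 1 - ρ := by linarith
  apply div_le_div₀
  · nlinarith
  · nlinarith
  · positivity
  · nlinarith [sq_nonneg (dist z w)]

theorem poissonKernel_le_cauchyKernel (z w : Circle) {ρ : ℝ} (hρ : ρ ∈ Ico (1 / 2 : ℝ) 1) :
    poissonKernel 0 (ρ * z) w ≤ 4 * cauchyKernel (1 - ρ) (dist z w) := by
  obtain ⟨h0, h1⟩ := hρ
  have h2 : 0 < 1 - ρ := by linarith
  rw [poissonKernel_radial, cauchyKernel, ← mul_div_assoc, div_le_div_iff₀ (by positivity)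
    (by positivity)]
  have hA : 0 ≤ (1 - ρ) ^ 2 := by positivity
  have hB : 0 ≤ dist z w ^ 2 := by positivity
  have h3 : (1 - ρ ^ 2) * ((1 - ρ) ^ 2 + dist z w ^ 2) =
    (1 - ρ) * ((1 + ρ) * ((1 - ρ) ^ 2 + dist z w ^ 2)) := by ring
  rw [h3, mul_comm 4, mul_assoc (1 - ρ) 4]
  refine mul_le_mul_of_nonneg_left ?_ h2.le
  nlinarith [mul_nonneg (sub_nonneg.2 h0) hB]

theorem poissonKernel_radial_nonneg (z w : Circle) {ρ : ℝ} (hρ : ρ ∈ Ico (0 : ℝ) 1) :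
    0 ≤ poissonKernel 0 (ρ * z) w :=
  (cauchyKernel_nonneg (by linarith [hρ.2]) _).trans (cauchyKernel_le_poissonKernel z w hρ)

theorem radial_mem_ball (z : Circle) {ρ : ℝ} (hρ : ρ ∈ Ico (0 : ℝ) 1) :
    (ρ : ℂ) * z ∈ Metric.ball (0 : ℂ) 1 := by
  simpa [Circle.norm_coe, abs_of_nonneg hρ.1] using hρ.2

theorem cauchyKernel_le_div_sq {δ x h : ℝ} (hδ : 0 < δ) (hh : 0 < h) (hx : h ≤ x) :
    cauchyKernel δ x ≤ δ / h ^ 2 := by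
  unfold cauchyKernel
  apply div_le_div_of_nonneg_left hδ.le (by positivity)
  nlinarith

/-- Take the least k with x ≤ 2^k δ. If k > 0, minimality gives x > 2^(k-1) δ, whence the decay
4^(-k). -/
theorem exists_dyadic_bound_cauchyKernel {δ x : ℝ} (hδ : 0 < δ) :
    ∃ k : ℕ, x ≤ 2 ^ k * δ ∧ cauchyKernel δ x ≤ 4 / (4 ^ k * δ) := by
  have hex : ∃ k : ℕ, x ≤ 2 ^ k * δ := by
    obtain ⟨k, hk⟩ := pow_unbounded_of_one_lt (x / δ) (one_lt_two (α := ℝ))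
    exact ⟨k, ((div_lt_iff₀ hδ).1 hk).le⟩
  classical
  refine ⟨Nat.find hex, Nat.find_spec hex, ?_⟩
  rcases h : Nat.find hex with _ | j
  · rw [pow_zero, one_mul, cauchyKernel, div_le_div_iff₀ (by positivity) hδ]
    nlinarith [sq_nonneg x]
  · have hj : 2 ^ j * δ < x := not_le.1 (Nat.find_min hex (by omega))
    refine (cauchyKernel_le_div_sq hδ (by positivity) hj.le).trans_eq ?_
    rw [show (4 : ℝ) = 2 ^ 2 by norm_num, ← pow_mul, pow_mul' (2 : ℝ) 2 (j + 1)]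
    field_simp
    ring

/-- Near z the kernel is dominated by a dyadic sum of ball indicators: the coefficient is of order
4^(-k)/δ and the ball has measure of order 2^k δ, so a geometric series results. Beyond distance h
the kernel is at most δ/h². -/
theorem lintegral_cauchyKernel_mul_le {z : Circle} {φ : Circle → ℝ≥0∞} (hφ : Measurable φ)
    {ε : ℝ≥0∞} {h : ℝ} (hh : 0 < h)
    (hε : ∀ s ∈ Ioc 0 h, ∫⁻ w in Metric.closedBall z s, φ w ∂normArcLength ≤
      ε * normArcLength (Metric.closedBall z s)) {δ : ℝ} (hδ : 0 < δ) :
    ∫⁻ w, ENNReal.ofReal (cauchyKernel δ (dist z w)) * φ w ∂normArcLength ≤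
      ENNReal.ofReal (δ / h ^ 2) * ∫⁻ w, φ w ∂normArcLength + 4 * ε := by
  -- Radii are truncated at h since the averages are controlled only up to that radius.
  let s : ℕ → ℝ := fun k => min (2 ^ k * δ) h
  have hs (k : ℕ) : s k ∈ Ioc 0 h := ⟨lt_min (by positivity) hh, min_le_right _ _⟩
  let c : ℕ → ℝ≥0∞ := fun k => ENNReal.ofReal (4 / (4 ^ k * δ))
  have hpt (w : Circle) : ENNReal.ofReal (cauchyKernel δ (dist z w)) * φ w ≤
      ENNReal.ofReal (δ / h ^ 2) * φ w +
        ∑' k, c k * (Metric.closedBall z (s k)).indicator φ w := by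
    rcases le_total h (dist z w) with hw | hw
    · refine le_add_right ?_
      gcongr
      exact cauchyKernel_le_div_sq hδ hh hw
    · refine le_add_left ?_
      obtain ⟨k, hk, hk'⟩ := exists_dyadic_bound_cauchyKernel (x := dist z w) hδ
      refine le_trans ?_ (ENNReal.le_tsum k)
      rw [indicator_of_mem (by rw [Metric.mem_closedBall']; exact le_min hk hw)]
      gcongr
      exact ENNReal.ofReal_le_ofReal hk'
  have hterm (k : ℕ) : ∫⁻ w, c k * (Metric.closedBall z (s k)).indicator φ w ∂normArcLength ≤
      2 * ε * 2⁻¹ ^ k := by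
    have hcm : Measurable ((Metric.closedBall z (s k)).indicator φ) :=
      hφ.indicator Metric.isClosed_closedBall.measurableSet
    rw [lintegral_const_mul _ hcm, lintegral_indicator Metric.isClosed_closedBall.measurableSet]
    calc _ ≤ c k * (ε * ENNReal.ofReal (2 ^ k * δ / 2)) := by
          gcongr
          refine (hε _ (hs k)).trans ?_
          gcongr
          refine (normArcLength_closedBall_le z _).trans (ENNReal.ofReal_le_ofReal ?_)
          have : s k ≤ 2 ^ k * δ := min_le_left _ _
          linarith
      _ = ε * ENNReal.ofReal (2 * (2⁻¹) ^ k) := by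
          rw [mul_left_comm, ← ENNReal.ofReal_mul (by positivity)]
          congr 2
          rw [show (4 : ℝ) = 2 * 2 by norm_num, mul_pow, inv_pow]
          field_simp
      _ = 2 * ε * 2⁻¹ ^ k := by
          rw [ENNReal.ofReal_mul (by norm_num), ENNReal.ofReal_pow (by norm_num),
            ENNReal.ofReal_inv_of_pos (by norm_num)]
          simp only [ENNReal.ofReal_ofNat]
          ring
  calc _ ≤ ∫⁻ w, (ENNReal.ofReal (δ / h ^ 2) * φ w +
        ∑' k, c k * (Metric.closedBall z (s k)).indicator φ w) ∂normArcLength :=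
        lintegral_mono hpt
    _ = ENNReal.ofReal (δ / h ^ 2) * ∫⁻ w, φ w ∂normArcLength +
        ∑' k, ∫⁻ w, c k * (Metric.closedBall z (s k)).indicator φ w ∂normArcLength := by
        rw [lintegral_add_left (hφ.const_mul _), lintegral_const_mul _ hφ, lintegral_tsum]
        exact fun k =>
          ((hφ.indicator Metric.isClosed_closedBall.measurableSet).const_mul _).aemeasurable
    _ ≤ ENNReal.ofReal (δ / h ^ 2) * ∫⁻ w, φ w ∂normArcLength + ∑' k, 2 * ε * 2⁻¹ ^ k := by
        gcongr with k
        exact hterm k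
    _ = _ := by
        rw [ENNReal.tsum_mul_left, ENNReal.tsum_geometric, ENNReal.one_sub_inv_two, inv_inv]
        ring

/-- At a Lebesgue point the averages of |F - F z| over small balls drop below ε/8; the dyadic bound
then yields ε/2 from nearby points, and letting δ → 0 makes the far part at most ε/2. -/
theorem ae_tendsto_lintegral_cauchyKernel {F : Circle → ℂ} (hF : StronglyMeasurable F)
    (hFi : Integrable F normArcLength) :
    ∀ᵐ z ∂normArcLength, Tendsto (fun δ : ℝ =>
      ∫⁻ w, ENNReal.ofReal (cauchyKernel δ (dist z w)) * ‖F w - F z‖ₑ ∂normArcLength)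
      (𝓝[>] 0) (𝓝 0) := by
  filter_upwards [(IsUnifLocDoublingMeasure.vitaliFamily normArcLength
    1).ae_tendsto_lintegral_enorm_sub_div hFi.locallyIntegrable] with z hz
  have hball := hz.comp (IsUnifLocDoublingMeasure.tendsto_closedBall_filterAt (K := 1)
    normArcLength (fun _ : ℝ => z) id tendsto_id (by
      filter_upwards [self_mem_nhdsWithin] with s hs
      simpa using (mem_Ioi.1 hs).le))
  have hmeas : Measurable fun w => ‖F w - F z‖ₑ := (hF.measurable.sub_const _).enorm
  have hfin : ∫⁻ w, ‖F w - F z‖ₑ ∂normArcLength ≠ ∞ := (hFi.sub (integrable_const _)).2.ne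
  rw [ENNReal.tendsto_nhds_zero]
  intro ε hε
  rcases eq_or_ne ε ∞ with rfl | hε'
  · simp
  have hε8 : 0 < ε / 8 := ENNReal.div_pos hε.ne' (by norm_num)
  obtain ⟨h, hh, hsub⟩ := mem_nhdsGT_iff_exists_Ioc_subset.1
    ((ENNReal.tendsto_nhds_zero.1 hball) (ε / 8) hε8)
  have hlim : Tendsto (fun δ : ℝ => ENNReal.ofReal (δ / h ^ 2) *
      ∫⁻ w, ‖F w - F z‖ₑ ∂normArcLength) (𝓝[>] 0) (𝓝 0) := by
    have h1 : Tendsto (fun δ : ℝ => ENNReal.ofReal (δ / h ^ 2)) (𝓝[>] 0) (𝓝 0) := by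
      have : Tendsto (fun δ : ℝ => ENNReal.ofReal (δ / h ^ 2)) (𝓝 0)
          (𝓝 (ENNReal.ofReal (0 / h ^ 2))) :=
        (ENNReal.continuous_ofReal.comp (continuous_id.div_const _)).tendsto 0
      rw [zero_div, ENNReal.ofReal_zero] at this
      exact this.mono_left nhdsWithin_le_nhds
    simpa using ENNReal.Tendsto.mul_const h1 (Or.inr hfin)
  filter_upwards [self_mem_nhdsWithin, (ENNReal.tendsto_nhds_zero.1 hlim) (ε / 2)
    (ENNReal.div_pos hε.ne' (by norm_num))] with δ hδ hδ'
  refine (lintegral_cauchyKernel_mul_le hmeas (ε := ε / 8) hh (fun s hs => ?_) hδ).trans ?_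
  · have := hsub hs
    simp only [mem_ofPred_eq, Function.comp_apply, id_eq] at this
    refine (ENNReal.div_le_iff_le_mul (Or.inr ?_) (Or.inl (measure_ne_top _ _))).1 this
    exact ENNReal.div_ne_top hε' (by norm_num)
  · calc _ ≤ ε / 2 + 4 * (ε / 8) := by gcongr
      _ = ε / 2 + ε / 2 := by
          congr 1
          rw [show (8 : ℝ≥0∞) = 4 * 2 by norm_num, ← mul_div_assoc]
          exact ENNReal.mul_div_mul_left _ _ (by norm_num) (by norm_num)
      _ = ε := ENNReal.add_halves ε

/-- **Fatou's theorem** for Poisson integrals of integrable functions on the circle. -/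
theorem ae_hasRadialLimit_of_poisson_representation {f : ℂ → ℂ} {F : Circle → ℂ}
    (hF : StronglyMeasurable F) (hFi : Integrable F normArcLength)
    (hf : ∀ w ∈ Metric.ball (0 : ℂ) 1,
      f w = ∫ ξ : Circle, (poissonKernel 0 w ξ : ℂ) * F ξ ∂normArcLength) :
    ∀ᵐ z ∂normArcLength, HasRadialLimit f z (F z) := by
  filter_upwards [ae_tendsto_lintegral_cauchyKernel hF hFi] with z hz
  have hsub : Tendsto (fun r : ℝ => 1 - r) (𝓝[<] 1) (𝓝[>] 0) := by
    refine tendsto_nhdsWithin_iff.2 ⟨?_, ?_⟩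
    · have : Tendsto (fun r : ℝ => 1 - r) (𝓝 1) (𝓝 (1 - 1)) :=
        (continuous_const.sub continuous_id).tendsto 1
      rw [sub_self] at this
      exact this.mono_left nhdsWithin_le_nhds
    · filter_upwards [self_mem_nhdsWithin] with r hr
      simpa using hr
  have hz' := ENNReal.Tendsto.const_mul (a := 4) (hz.comp hsub) (Or.inr (by norm_num))
  rw [mul_zero] at hz'
  unfold HasRadialLimit
  rw [tendsto_iff_edist_tendsto_0]
  refine tendsto_of_tendsto_of_tendsto_of_le_of_le' tendsto_const_nhds hz'
    (Eventually.of_forall fun _ => zero_le) ?_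
  filter_upwards [Ico_mem_nhdsLT (show (1 / 2 : ℝ) < 1 by norm_num)] with r hr
  have hr0 : r ∈ Ico (0 : ℝ) 1 := ⟨by linarith [hr.1], hr.2⟩
  have hw := radial_mem_ball z hr0
  have hP := continuous_poissonKernel_circle hw
  have hPC : Continuous fun ξ : Circle => (poissonKernel 0 (r * z) ξ : ℂ) :=
    Complex.continuous_ofReal.comp hP
  obtain ⟨B, hB⟩ := isCompact_univ.exists_bound_of_continuousOn hPC.continuousOn
  have hint : Integrable (fun ξ : Circle => (poissonKernel 0 (r * z) ξ : ℂ) * F ξ)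
      normArcLength :=
    hFi.bdd_mul hPC.aestronglyMeasurable (Eventually.of_forall fun ξ => hB ξ (mem_univ _))
  have hint1 : Integrable (fun ξ : Circle => (poissonKernel 0 (r * z) ξ : ℂ) * F z)
      normArcLength :=
    (integrable_const (F z)).bdd_mul hPC.aestronglyMeasurable
      (Eventually.of_forall fun ξ => hB ξ (mem_univ _))
  have heq : f (r * z) - F z =
      ∫ ξ : Circle, (poissonKernel 0 (r * z) ξ : ℂ) * (F ξ - F z) ∂normArcLength := by
    have h1 : ∫ ξ : Circle, (poissonKernel 0 (r * z) ξ : ℂ) * F z ∂normArcLength = F z := by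
      rw [integral_mul_const, integral_complex_ofReal, integral_poissonKernel hw]
      simp
    simp_rw [mul_sub]
    rw [integral_sub hint hint1, h1, hf _ hw]
  rw [edist_eq_enorm_sub, heq]
  simp only [Function.comp_apply]
  rw [← lintegral_const_mul' _ _ (by norm_num)]
  refine (enorm_integral_le_lintegral_enorm _).trans (lintegral_mono fun ξ => ?_)
  rw [enorm_mul, ← mul_assoc]
  gcongr
  rw [← ofReal_norm, Complex.norm_real, Real.norm_eq_abs,
    abs_of_nonneg (poissonKernel_radial_nonneg z ξ hr0),
    show (4 : ℝ≥0∞) = ENNReal.ofReal 4 by norm_num, ← ENNReal.ofReal_mul (by norm_num)]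
  exact ENNReal.ofReal_le_ofReal (poissonKernel_le_cauchyKernel z ξ hr)

/-! ### Telescoping mean oscillations -/

section Comparison

variable {Ω : Type*} [MeasurableSpace Ω]

theorem enorm_sub_integral_le {ν : Measure Ω} [IsProbabilityMeasure ν] {F : Ω → ℂ}
    (hF : Integrable F ν) (c : ℂ) : ‖c - ∫ y, F y ∂ν‖ₑ ≤ ∫⁻ y, ‖c - F y‖ₑ ∂ν := by
  have : c - ∫ y, F y ∂ν = ∫ y, (c - F y) ∂ν := by
    rw [integral_sub (integrable_const c) hF, integral_const, probReal_univ, one_smul]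
  rw [this]
  exact enorm_integral_le_lintegral_enorm _

theorem enorm_integral_sub_integral_le {μ ν : Measure Ω} [IsProbabilityMeasure μ]
    [IsProbabilityMeasure ν] {F : Ω → ℂ} (hμ : Integrable F μ) (hν : Integrable F ν) :
    ‖∫ x, F x ∂μ - ∫ y, F y ∂ν‖ₑ ≤ ∫⁻ x, ∫⁻ y, ‖F x - F y‖ₑ ∂ν ∂μ := by
  have : ∫ x, F x ∂μ - ∫ y, F y ∂ν = ∫ x, (F x - ∫ y, F y ∂ν) ∂μ := by
    rw [integral_sub hμ (integrable_const _), integral_const, probReal_univ, one_smul]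
  rw [this]
  exact (enorm_integral_le_lintegral_enorm _).trans
    (lintegral_mono fun x => enorm_sub_integral_le hν (F x))

theorem lintegral_enorm_le_enorm_integral_add {μ ν : Measure Ω} [IsProbabilityMeasure μ]
    [IsProbabilityMeasure ν] {F : Ω → ℂ} (hν : Integrable F ν) :
    ∫⁻ x, ‖F x‖ₑ ∂μ ≤ ‖∫ y, F y ∂ν‖ₑ + ∫⁻ x, ∫⁻ y, ‖F x - F y‖ₑ ∂ν ∂μ := by
  calc ∫⁻ x, ‖F x‖ₑ ∂μ ≤ ∫⁻ x, (‖∫ y, F y ∂ν‖ₑ + ∫⁻ y, ‖F x - F y‖ₑ ∂ν) ∂μ := by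
        refine lintegral_mono fun x => ?_
        calc ‖F x‖ₑ = ‖∫ y, F y ∂ν + (F x - ∫ y, F y ∂ν)‖ₑ := by rw [add_sub_cancel]
          _ ≤ ‖∫ y, F y ∂ν‖ₑ + ‖F x - ∫ y, F y ∂ν‖ₑ := enorm_add_le _ _
          _ ≤ _ := by
            gcongr
            exact enorm_sub_integral_le hν (F x)
    _ = _ := by rw [lintegral_add_left measurable_const, lintegral_const, measure_univ, mul_one]

theorem lintegral_lintegral_le_of_le_smul {μ ν κ : Measure Ω} {K : ℝ≥0∞} (hK : K ≠ ∞) (hμ : μ ≤ K • κ)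
    (hν : ν ≤ K • κ) (g : Ω → Ω → ℝ≥0∞) :
    ∫⁻ x, ∫⁻ y, g x y ∂ν ∂μ ≤ K ^ 2 * ∫⁻ x, ∫⁻ y, g x y ∂κ ∂κ := by
  calc _ ≤ ∫⁻ x, K * ∫⁻ y, g x y ∂κ ∂(K • κ) := by
        refine lintegral_mono' hμ fun x => ?_
        refine (lintegral_mono' hν le_rfl).trans_eq ?_
        rw [lintegral_smul_measure, smul_eq_mul]
    _ ≤ _ := by
      rw [lintegral_smul_measure, smul_eq_mul, lintegral_const_mul' _ _ hK, sq, mul_assoc]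

/-- If the means of `F` over a sequence of probability measures tend to `0`, then the mean of `‖F‖`
is controlled by the mean oscillations of `F` along the sequence. -/
theorem lintegral_enorm_le_tsum_oscillation {ν : Measure Ω} [IsProbabilityMeasure ν]
    {νs κ : ℕ → Measure Ω} [∀ j, IsProbabilityMeasure (νs j)] {K : ℝ≥0∞} (hK : K ≠ ∞)
    {F : Ω → ℂ} (hF : ∀ j, Integrable F (νs j)) (hν : ν ≤ K • κ 0) (h0 : ∀ j, νs j ≤ K • κ j)
    (h1 : ∀ j, νs (j + 1) ≤ K • κ j) (hlim : Tendsto (fun j => ∫ x, F x ∂νs j) atTop (𝓝 0)) :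
    ∫⁻ x, ‖F x‖ₑ ∂ν ≤ 2 * K ^ 2 * ∑' j, ∫⁻ x, ∫⁻ y, ‖F x - F y‖ₑ ∂κ j ∂κ j := by
  set J : ℕ → ℝ≥0∞ := fun j => ∫⁻ x, ∫⁻ y, ‖F x - F y‖ₑ ∂κ j ∂κ j
  have hstep (j : ℕ) : ‖∫ x, F x ∂νs j‖ₑ ≤ ‖∫ x, F x ∂νs (j + 1)‖ₑ + K ^ 2 * J j := by
    calc ‖∫ x, F x ∂νs j‖ₑ =
          ‖∫ x, F x ∂νs (j + 1) + (∫ x, F x ∂νs j - ∫ x, F x ∂νs (j + 1))‖ₑ := by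
          rw [add_sub_cancel]
      _ ≤ ‖∫ x, F x ∂νs (j + 1)‖ₑ + ‖∫ x, F x ∂νs j - ∫ x, F x ∂νs (j + 1)‖ₑ :=
          enorm_add_le _ _
      _ ≤ _ := by
          gcongr
          exact (enorm_integral_sub_integral_le (hF _) (hF _)).trans
            (lintegral_lintegral_le_of_le_smul hK (h0 j) (h1 j) _)
  have hchain (n : ℕ) : ‖∫ x, F x ∂νs 0‖ₑ ≤
      ‖∫ x, F x ∂νs n‖ₑ + K ^ 2 * ∑ j ∈ Finset.range n, J j := by
    induction n with
    | zero => simp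
    | succ n ih =>
      refine ih.trans ?_
      rw [Finset.sum_range_succ, mul_add]
      refine (add_le_add_left (hstep n) _).trans_eq ?_
      ring
  have hzero : ‖∫ x, F x ∂νs 0‖ₑ ≤ K ^ 2 * ∑' j, J j := by
    have hl : Tendsto (fun n => ‖∫ x, F x ∂νs n‖ₑ + K ^ 2 * ∑' j, J j) atTop
        (𝓝 (0 + K ^ 2 * ∑' j, J j)) := by
      refine Tendsto.add ?_ tendsto_const_nhds
      simpa [Function.comp_def] using (continuous_enorm.tendsto (0 : ℂ)).comp hlim
    rw [zero_add] at hl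
    refine ge_of_tendsto' hl fun n => (hchain n).trans ?_
    gcongr
    exact ENNReal.sum_le_tsum _
  -- One copy of the sum comes from the chain of means, the other from passing from ν to the first
  -- measure of the chain.
  calc _ ≤ K ^ 2 * ∑' j, J j + K ^ 2 * J 0 :=
        (lintegral_enorm_le_enorm_integral_add (hF 0)).trans
          (add_le_add hzero (lintegral_lintegral_le_of_le_smul hK hν (h0 0) _))
    _ ≤ K ^ 2 * ∑' j, J j + K ^ 2 * ∑' j, J j := by
        gcongr
        exact ENNReal.le_tsum 0
    _ = _ := by ring

end Comparison

/-! ### Pointwise kernel estimates and their sum over scales -/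

section KernelEstimates

theorem cauchyKernel_mul_one_add_sq_le {δ x : ℝ} (hδ : 0 < δ) :
    cauchyKernel δ x * (1 + x / δ) ^ 2 ≤ 2 / δ := by
  have h : 1 + x / δ = (δ + x) / δ := by field_simp
  rw [h, cauchyKernel, div_pow, div_mul_div_comm, div_le_div_iff₀ (by positivity) hδ]
  have := mul_nonneg (pow_pos hδ 2).le (sq_nonneg (δ - x))
  nlinarith

/-- Since d ≤ δ (1 + x/δ)(1 + y/δ), the weight grows in y with exponent 1 + β ≤ 2. One kernel factor
absorbs this growth and the other is kept for integration. -/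
theorem cauchyKernel_sq_mul_rpow_le {β δ x y d : ℝ} (hβ : 0 < β) (hβ1 : β ≤ 1) (hδ : 0 < δ)
    (hx : 0 ≤ x) (hy : 0 ≤ y) (hd : 0 ≤ d) (hdxy : d ≤ x + y) :
    cauchyKernel δ y ^ 2 * d ^ (1 + β) ≤
      cauchyKernel δ y * (2 * δ ^ β * (1 + x / δ) ^ (1 + β)) := by
  have hQ := cauchyKernel_nonneg hδ y
  have h1 : d ≤ δ * (1 + x / δ) * (1 + y / δ) := by
    have : δ * (1 + x / δ) * (1 + y / δ) = δ + x + y + x * y / δ := by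
      field_simp
      ring
    rw [this]
    have : 0 ≤ x * y / δ := by positivity
    linarith
  have hyδ : 1 ≤ 1 + y / δ := le_add_of_nonneg_right (by positivity)
  have h2 : d ^ (1 + β) ≤ δ ^ (1 + β) * (1 + x / δ) ^ (1 + β) * (1 + y / δ) ^ 2 := by
    calc d ^ (1 + β) ≤ (δ * (1 + x / δ) * (1 + y / δ)) ^ (1 + β) :=
          Real.rpow_le_rpow hd h1 (by linarith)
      _ = δ ^ (1 + β) * (1 + x / δ) ^ (1 + β) * (1 + y / δ) ^ (1 + β) := by
          rw [Real.mul_rpow (by positivity) (by positivity),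
            Real.mul_rpow (by positivity) (by positivity)]
      _ ≤ _ := by
          gcongr
          rw [← Real.rpow_natCast]
          exact Real.rpow_le_rpow_of_exponent_le hyδ (by push_cast; linarith)
  rw [sq, mul_assoc]
  refine mul_le_mul_of_nonneg_left ?_ hQ
  calc cauchyKernel δ y * d ^ (1 + β) ≤
        cauchyKernel δ y * (δ ^ (1 + β) * (1 + x / δ) ^ (1 + β) * (1 + y / δ) ^ 2) := by gcongr
    _ = δ ^ (1 + β) * (1 + x / δ) ^ (1 + β) * (cauchyKernel δ y * (1 + y / δ) ^ 2) := by ring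
    _ ≤ δ ^ (1 + β) * (1 + x / δ) ^ (1 + β) * (2 / δ) := by
        gcongr
        exact cauchyKernel_mul_one_add_sq_le hδ
    _ = _ := by
        rw [Real.rpow_add hδ, Real.rpow_one]
        field_simp

theorem cauchyKernel_mul_sqrt_le {β δ x : ℝ} (hδ : 0 < δ) (hx : 0 ≤ x) :
    cauchyKernel δ x * √(2 * δ ^ β * (1 + x / δ) ^ (1 + β)) ≤
      4 * (δ ^ (-(1 - β / 2)) * (1 + x / δ) ^ (-(1 - β / 2 + 1 / 2))) := by
  have hq : 0 < 1 + x / δ := by positivity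
  set q := 1 + x / δ with hqdef
  have h1 : cauchyKernel δ x ≤ 2 / δ / q ^ 2 := by
    rw [le_div_iff₀ (by positivity)]
    exact cauchyKernel_mul_one_add_sq_le hδ
  have h2 : √(2 * δ ^ β * q ^ (1 + β)) ≤ 2 * (δ ^ (β / 2) * q ^ ((1 + β) / 2)) := by
    rw [Real.sqrt_le_left (by positivity)]
    have e1 : (δ ^ (β / 2)) ^ 2 = δ ^ β := by
      rw [← Real.rpow_natCast, ← Real.rpow_mul hδ.le]
      norm_num
    have e2 : (q ^ ((1 + β) / 2)) ^ 2 = q ^ (1 + β) := by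
      rw [← Real.rpow_natCast, ← Real.rpow_mul hq.le]
      norm_num
    rw [mul_pow, mul_pow, e1, e2]
    have : 0 ≤ δ ^ β * q ^ (1 + β) := by positivity
    nlinarith
  calc _ ≤ 2 / δ / q ^ 2 * (2 * (δ ^ (β / 2) * q ^ ((1 + β) / 2))) := by gcongr
    _ = 4 * ((δ ^ (β / 2) / δ) * (q ^ ((1 + β) / 2) / q ^ 2)) := by ring
    _ = _ := by
      congr 2
      · rw [div_eq_mul_inv, ← Real.rpow_neg_one, ← Real.rpow_add hδ]
        congr 1
        ring
      · rw [← Real.rpow_natCast, ← Real.rpow_sub hq]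
        congr 1
        push_cast
        ring

/-- The right side is an increment of t/(1 + t) from t = √q to 2√q. Quadrupling q doubles √q, so
along scales of ratio 4 these increments telescope. -/
theorem rpow_mul_one_add_rpow_le {s q : ℝ} (hs : 1 / 2 ≤ s) (hq : 0 < q) :
    q ^ s * (1 + q) ^ (-(s + 1 / 2)) ≤
      4 * (2 * √q / (1 + 2 * √q) - √q / (1 + √q)) := by
  have ht : 0 < √q := Real.sqrt_pos.2 hq
  have hqt : √q ^ 2 = q := Real.sq_sqrt hq.le
  have h1 : q ^ s * (1 + q) ^ (-(s + 1 / 2)) =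
      (q / (1 + q)) ^ (s - 1 / 2) * (√q / (1 + q)) := by
    rw [Real.div_rpow hq.le (by positivity), Real.sqrt_eq_rpow, div_mul_div_comm,
      ← Real.rpow_add hq, ← Real.rpow_add_one (by positivity), Real.rpow_neg (by positivity),
      div_eq_mul_inv]
    congr 2
    · ring
    · congr 1
      ring
  have h2 : (q / (1 + q)) ^ (s - 1 / 2) ≤ 1 :=
    Real.rpow_le_one (by positivity) ((div_le_one (by positivity)).2 (by linarith)) (by linarith)
  have h3 : 2 * √q / (1 + 2 * √q) - √q / (1 + √q) = √q / ((1 + 2 * √q) * (1 + √q)) := by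
    field_simp
    ring
  rw [h1, h3]
  calc _ ≤ 1 * (√q / (1 + q)) := by gcongr
    _ ≤ _ := by
      rw [one_mul, ← mul_div_assoc, div_le_div_iff₀ (by positivity) (by positivity)]
      have : (1 + 2 * √q) * (1 + √q) ≤ 4 * (1 + q) := by
        nlinarith [sq_nonneg (1 - √q)]
      nlinarith

/-- Once x^(-s) is factored out, a term depends only on x/(δ/4^j), which quadruples with j. The
telescoping sum is at most 1 whatever δ and n are. -/
theorem sum_rpow_mul_one_add_rpow_le {s δ x : ℝ} (hs : 1 / 2 ≤ s) (hδ : 0 < δ) (hx : 0 < x)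
    (n : ℕ) :
    ∑ j ∈ Finset.range n, (δ / 4 ^ j) ^ (-s) * (1 + x / (δ / 4 ^ j)) ^ (-(s + 1 / 2)) ≤
      4 * x ^ (-s) := by
  let t : ℕ → ℝ := fun j => √(x / (δ / 4 ^ j))
  have ht (j : ℕ) : t (j + 1) = 2 * t j := by
    have : x / (δ / 4 ^ (j + 1)) = 2 ^ 2 * (x / (δ / 4 ^ j)) := by
      rw [pow_succ]
      field_simp
      norm_num
    simp only [t]
    rw [this, Real.sqrt_mul (by norm_num), Real.sqrt_sq (by norm_num)]
  have htn (j : ℕ) : 0 ≤ t j := Real.sqrt_nonneg _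
  have hterm (j : ℕ) : (δ / 4 ^ j) ^ (-s) * (1 + x / (δ / 4 ^ j)) ^ (-(s + 1 / 2)) ≤
      4 * x ^ (-s) * (t (j + 1) / (1 + t (j + 1)) - t j / (1 + t j)) := by
    have hδj : 0 < δ / 4 ^ j := by positivity
    have h := rpow_mul_one_add_rpow_le hs (div_pos hx hδj)
    have e : (δ / 4 ^ j) ^ (-s) = x ^ (-s) * (x / (δ / 4 ^ j)) ^ s := by
      rw [Real.div_rpow hx.le hδj.le, Real.rpow_neg hx.le, Real.rpow_neg hδj.le]
      have := (Real.rpow_pos_of_pos hx s).ne'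
      field_simp
    rw [e, ht, mul_assoc, mul_comm (4 : ℝ), mul_assoc]
    gcongr
  calc _ ≤ ∑ j ∈ Finset.range n,
        4 * x ^ (-s) * (t (j + 1) / (1 + t (j + 1)) - t j / (1 + t j)) :=
        Finset.sum_le_sum fun j _ => hterm j
    _ = 4 * x ^ (-s) * (t n / (1 + t n) - t 0 / (1 + t 0)) := by
        rw [← Finset.mul_sum, Finset.sum_range_sub (fun j => t j / (1 + t j))]
    _ ≤ 4 * x ^ (-s) * 1 := by
        gcongr
        have h1 : t n / (1 + t n) ≤ 1 :=
          (div_le_one (by linarith [htn n])).2 (by linarith)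
        have h2 : 0 ≤ t 0 / (1 + t 0) := div_nonneg (htn 0) (by linarith [htn 0])
        linarith
    _ = _ := mul_one _

end KernelEstimates

/-! ### From oscillations over the arc to a Riesz potential -/

theorem norm_coe_sub_eq_dist (z w : Circle) : ‖(z : ℂ) - w‖ = dist z w :=
  (dist_eq_norm (z : ℂ) (w : ℂ)).symm

theorem norm_one_sub_mul_inv (z w : Circle) : ‖1 - ((z * w⁻¹ : Circle) : ℂ)‖ = dist z w := by
  rw [dist_comm, ← norm_coe_sub_eq_dist, ← mul_one ‖1 - _‖, ← Circle.norm_coe w, ← norm_mul]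
  congr 1
  rw [Circle.coe_mul, Circle.coe_inv, sub_mul, mul_assoc, inv_mul_cancel₀ w.coe_ne_zero]
  simp

theorem measurable_poissonKernel_radial (z : Circle) {ρ : ℝ} (hρ : ρ ∈ Ico (0 : ℝ) 1) :
    Measurable fun w : Circle => ENNReal.ofReal (poissonKernel 0 (ρ * z) w) :=
  (continuous_poissonKernel_circle (radial_mem_ball z hρ)).measurable.ennreal_ofReal

theorem measurable_cauchyKernel_dist (z : Circle) {δ : ℝ} (hδ : 0 < δ) :
    Measurable fun w : Circle => ENNReal.ofReal (cauchyKernel δ (dist z w)) :=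
  ((continuous_cauchyKernel hδ).comp (by fun_prop)).measurable.ennreal_ofReal

theorem lintegral_poissonKernel (z : Circle) {ρ : ℝ} (hρ : ρ ∈ Ico (0 : ℝ) 1) :
    ∫⁻ w : Circle, ENNReal.ofReal (poissonKernel 0 (ρ * z) w) ∂normArcLength = 1 := by
  have hw := radial_mem_ball z hρ
  rw [← ofReal_integral_eq_lintegral_ofReal, integral_poissonKernel hw, ENNReal.ofReal_one]
  · exact (continuous_poissonKernel_circle hw).integrable_of_hasCompactSupport
      (HasCompactSupport.of_compactSpace _)
  · exact Eventually.of_forall fun w => poissonKernel_radial_nonneg z w hρ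

theorem lintegral_cauchyKernel_le_one (z : Circle) {δ : ℝ} (hδ : δ ∈ Ioc (0 : ℝ) 1) :
    ∫⁻ w : Circle, ENNReal.ofReal (cauchyKernel δ (dist z w)) ∂normArcLength ≤ 1 := by
  have hρ : 1 - δ ∈ Ico (0 : ℝ) 1 := ⟨by linarith [hδ.2], by linarith [hδ.1]⟩
  rw [← lintegral_poissonKernel z hρ]
  refine lintegral_mono fun w => ENNReal.ofReal_le_ofReal ?_
  simpa using cauchyKernel_le_poissonKernel z w hρ

/-- The inner integral of the Dirichlet-type integral. -/
noncomputable def energyDensity (β : ℝ) (I : Set Circle) (F : Circle → ℂ) (z : Circle) : ℝ≥0∞ :=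
  ∫⁻ w in I, ENNReal.ofReal (‖F z - F w‖ ^ 2 / ‖(z : ℂ) - w‖ ^ (1 + β)) ∂normArcLength

theorem measurable_energyDensity {β : ℝ} {I : Set Circle} {F : Circle → ℂ} (hF : Measurable F) :
    Measurable (energyDensity β I F) := by
  unfold energyDensity
  refine Measurable.lintegral_prod_right' (f := fun p : Circle × Circle =>
    ENNReal.ofReal (‖F p.1 - F p.2‖ ^ 2 / ‖(p.1 : ℂ) - p.2‖ ^ (1 + β))) ?_
  have h1 : Measurable fun p : Circle × Circle => ‖F p.1 - F p.2‖ :=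
    ((hF.comp measurable_fst).sub (hF.comp measurable_snd)).norm
  have h2 : Measurable fun p : Circle × Circle => ‖(p.1 : ℂ) - p.2‖ :=
    Continuous.measurable (by fun_prop)
  exact ((h1.pow_const 2).div (h2.pow_const (1 + β))).ennreal_ofReal

/-- Cauchy–Schwarz with the weight |z - w|^(1 + β): one factor is the energy density, and the other
integrates one remaining kernel, of total mass at most 1. -/
theorem setLIntegral_cauchyKernel_mul_sub_le {β : ℝ} (hβ : 0 < β) (hβ1 : β ≤ 1) {I : Set Circle}
    {F : Circle → ℂ} (hF : Measurable F) (ζ z : Circle) {δ : ℝ} (hδ : δ ∈ Ioc (0 : ℝ) 1) :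
    ∫⁻ w in I, ENNReal.ofReal (cauchyKernel δ (dist ζ w)) * ‖F z - F w‖ₑ ∂normArcLength ≤
      energyDensity β I F z ^ (1 / 2 : ℝ) *
        ENNReal.ofReal √(2 * δ ^ β * (1 + dist ζ z / δ) ^ (1 + β)) := by
  set a : Circle → ℝ := fun w => ‖F z - F w‖ ^ 2 / ‖(z : ℂ) - w‖ ^ (1 + β)
  set b : Circle → ℝ := fun w => cauchyKernel δ (dist ζ w) ^ 2 * dist z w ^ (1 + β)
  have hcβ : 0 < 1 + β := by linarith
  have ha : Measurable a :=
    ((measurable_const.sub hF).norm.pow_const 2).div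
      ((show Continuous fun w : Circle => ‖(z : ℂ) - w‖ by fun_prop).measurable.pow_const _)
  have hb : Measurable b :=
    (((continuous_cauchyKernel hδ.1).comp (by fun_prop)).measurable.pow_const 2).mul
      ((show Continuous fun w : Circle => dist z w by fun_prop).measurable.pow_const _)
  have ha0 (w) : 0 ≤ a w := by positivity
  have hb0 (w) : 0 ≤ b w := by positivity
  have hpt (w : Circle) : ENNReal.ofReal (cauchyKernel δ (dist ζ w)) * ‖F z - F w‖ₑ ≤
      ((fun w => ENNReal.ofReal √(a w)) * fun w => ENNReal.ofReal √(b w)) w := by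
    rw [Pi.mul_apply, ← ENNReal.ofReal_mul (by positivity), ← Real.sqrt_mul (ha0 w),
      ← ofReal_norm, ← ENNReal.ofReal_mul (cauchyKernel_nonneg hδ.1 _)]
    apply ENNReal.ofReal_le_ofReal
    apply Real.le_sqrt_of_sq_le
    rcases eq_or_ne z w with rfl | hzw
    · simpa using mul_nonneg (ha0 z) (hb0 z)
    · have hd : 0 < dist z w := dist_pos.2 hzw
      have : dist z w ^ (1 + β) ≠ 0 := (Real.rpow_pos_of_pos hd _).ne'
      simp only [a, b, norm_coe_sub_eq_dist]
      field_simp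
      exact le_rfl
  have hsq (c : Circle → ℝ) (hc : ∀ w, 0 ≤ c w) (w : Circle) :
      ENNReal.ofReal √(c w) ^ (2 : ℝ) = ENNReal.ofReal (c w) := by
    rw [ENNReal.ofReal_rpow_of_nonneg (Real.sqrt_nonneg _) (by norm_num), Real.rpow_two,
      Real.sq_sqrt (hc w)]
  refine (lintegral_mono hpt).trans ((ENNReal.lintegral_mul_le_Lp_mul_Lq _
    Real.HolderConjugate.two_two ha.sqrt.ennreal_ofReal.aemeasurable
    hb.sqrt.ennreal_ofReal.aemeasurable).trans ?_)
  simp_rw [hsq a ha0, hsq b hb0]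
  refine mul_le_mul' le_rfl ?_
  set R : ℝ := 2 * δ ^ β * (1 + dist ζ z / δ) ^ (1 + β)
  have hδ0 := hδ.1
  have hR : 0 ≤ R := by positivity
  have hle : ∫⁻ w in I, ENNReal.ofReal (b w) ∂normArcLength ≤ ENNReal.ofReal R := by
    calc _ ≤ ∫⁻ w, ENNReal.ofReal (cauchyKernel δ (dist ζ w)) * ENNReal.ofReal R
          ∂normArcLength := by
          refine (setLIntegral_le_lintegral _ _).trans (lintegral_mono fun w => ?_)
          rw [← ENNReal.ofReal_mul (cauchyKernel_nonneg hδ.1 _)]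
          apply ENNReal.ofReal_le_ofReal
          refine cauchyKernel_sq_mul_rpow_le hβ hβ1 hδ.1 dist_nonneg dist_nonneg dist_nonneg ?_
          rw [dist_comm ζ z]
          exact dist_triangle _ _ _
      _ ≤ 1 * ENNReal.ofReal R := by
          rw [lintegral_mul_const _ (measurable_cauchyKernel_dist ζ hδ.1)]
          gcongr
          exact lintegral_cauchyKernel_le_one ζ hδ
      _ = _ := one_mul _
  calc _ ≤ ENNReal.ofReal R ^ (1 / 2 : ℝ) := by gcongr
    _ = ENNReal.ofReal √R := by
      rw [ENNReal.ofReal_rpow_of_nonneg hR (by norm_num), Real.sqrt_eq_rpow]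

/-- The measure on `I` with density the kernel `δ / (δ² + |ζ - w|²)`. -/
noncomputable def localCauchy (I : Set Circle) (ζ : Circle) (δ : ℝ) : Measure Circle :=
  (normArcLength.restrict I).withDensity fun w => ENNReal.ofReal (cauchyKernel δ (dist ζ w))

theorem oscillation_localCauchy_le {β : ℝ} (hβ : 0 < β) (hβ1 : β ≤ 1) {I : Set Circle}
    {F : Circle → ℂ} (hF : Measurable F) (ζ : Circle) {δ : ℝ} (hδ : δ ∈ Ioc (0 : ℝ) 1) :
    ∫⁻ z, ∫⁻ w, ‖F z - F w‖ₑ ∂localCauchy I ζ δ ∂localCauchy I ζ δ ≤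
      ∫⁻ z in I, energyDensity β I F z ^ (1 / 2 : ℝ) * ENNReal.ofReal (4 *
        (δ ^ (-(1 - β / 2)) * (1 + dist ζ z / δ) ^ (-(1 - β / 2 + 1 / 2)))) ∂normArcLength := by
  have hm := measurable_cauchyKernel_dist ζ hδ.1
  refine (lintegral_withDensity_le_lintegral_mul _ hm _).trans (lintegral_mono fun z => ?_)
  rw [Pi.mul_apply]
  calc _ ≤ ENNReal.ofReal (cauchyKernel δ (dist ζ z)) * (energyDensity β I F z ^ (1 / 2 : ℝ) *
        ENNReal.ofReal √(2 * δ ^ β * (1 + dist ζ z / δ) ^ (1 + β))) := by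
        gcongr
        exact (lintegral_withDensity_le_lintegral_mul _ hm _).trans
          (setLIntegral_cauchyKernel_mul_sub_le hβ hβ1 hF ζ z hδ)
    _ = energyDensity β I F z ^ (1 / 2 : ℝ) * ENNReal.ofReal (cauchyKernel δ (dist ζ z) *
        √(2 * δ ^ β * (1 + dist ζ z / δ) ^ (1 + β))) := by
        rw [ENNReal.ofReal_mul (cauchyKernel_nonneg hδ.1 _)]
        ring
    _ ≤ _ := by
        exact mul_le_mul' le_rfl (ENNReal.ofReal_le_ofReal
          (cauchyKernel_mul_sqrt_le hδ.1 (dist_nonneg (x := ζ) (y := z))))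

theorem tsum_le_circleKernel {s δ : ℝ} (hs : 1 / 2 ≤ s) (hδ : 0 < δ) (ζ z : Circle) :
    ∑' j : ℕ, ENNReal.ofReal (4 *
      ((δ / 4 ^ j) ^ (-s) * (1 + dist ζ z / (δ / 4 ^ j)) ^ (-(s + 1 / 2)))) ≤
      16 * circleKernel s (ζ * z⁻¹) := by
  rw [circleKernel, norm_one_sub_mul_inv]
  rcases eq_or_lt_of_le (dist_nonneg (x := ζ) (y := z)) with h | h
  · rw [← h, ENNReal.ofReal_zero, ENNReal.zero_rpow_of_neg (by linarith),
      ENNReal.mul_top (by norm_num)]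
    exact le_top
  · rw [ENNReal.ofReal_rpow_of_pos h, show (16 : ℝ≥0∞) = ENNReal.ofReal 16 by norm_num,
      ← ENNReal.ofReal_mul (by norm_num)]
    refine ENNReal.tsum_le_of_sum_range_le fun n => ?_
    rw [← ENNReal.ofReal_sum_of_nonneg fun j _ => by positivity, ← Finset.mul_sum]
    apply ENNReal.ofReal_le_ofReal
    linarith [sum_rpow_mul_one_add_rpow_le hs hδ h n]

/-- The energy density does not depend on the scale, so the sum over j falls on the profiles alone
and produces the Riesz kernel. -/
theorem tsum_oscillation_localCauchy_le {β : ℝ} (hβ : 0 < β) (hβ1 : β ≤ 1) {I : Set Circle}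
    {F : Circle → ℂ} (hF : Measurable F) (ζ : Circle) {δ : ℝ} (hδ : δ ∈ Ioc (0 : ℝ) 1) :
    ∑' j : ℕ, ∫⁻ z, ∫⁻ w, ‖F z - F w‖ₑ ∂localCauchy I ζ (δ / 4 ^ j) ∂localCauchy I ζ (δ / 4 ^ j) ≤
      16 * ∫⁻ z in I, circleKernel (1 - β / 2) (ζ * z⁻¹) * energyDensity β I F z ^ (1 / 2 : ℝ)
        ∂normArcLength := by
  have hδj (j : ℕ) : δ / 4 ^ j ∈ Ioc (0 : ℝ) 1 := by
    have := hδ.1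
    refine ⟨by positivity, (div_le_self hδ.1.le ?_).trans hδ.2⟩
    exact one_le_pow₀ (by norm_num)
  refine (ENNReal.tsum_le_tsum fun j => oscillation_localCauchy_le hβ hβ1 hF ζ (hδj j)).trans ?_
  rw [← lintegral_tsum, ← lintegral_const_mul' _ _ (by norm_num)]
  · refine lintegral_mono fun z => ?_
    rw [ENNReal.tsum_mul_left, mul_comm, ← mul_assoc]
    gcongr
    exact tsum_le_circleKernel (by linarith) hδ.1 ζ z
  · intro j
    have h1 : Measurable fun z : Circle => 4 * ((δ / 4 ^ j) ^ (-(1 - β / 2)) *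
        (1 + dist ζ z / (δ / 4 ^ j)) ^ (-(1 - β / 2 + 1 / 2))) := by
      have : Measurable fun z : Circle => 1 + dist ζ z / (δ / 4 ^ j) :=
        Continuous.measurable (by fun_prop)
      exact ((this.pow_const _).const_mul _).const_mul _
    exact (((measurable_energyDensity hF).pow_const _).mul h1.ennreal_ofReal).aemeasurable

/-! ### Restricted Poisson kernels and the bound for the mean -/

/-- The Poisson kernel of the point `ρ ζ`, restricted to `I` and normalized. -/
noncomputable def localPoisson (I : Set Circle) (ζ : Circle) (ρ : ℝ) : Measure Circle :=
  (∫⁻ w in I, ENNReal.ofReal (poissonKernel 0 (ρ * ζ) w) ∂normArcLength)⁻¹ •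
    (normArcLength.restrict I).withDensity fun w => ENNReal.ofReal (poissonKernel 0 (ρ * ζ) w)

/-- Even when ζ is close to an end of the arc, a subarc of length δ adjacent to ζ fits inside. There
the kernel is at least 1/δ, and the subarc has normalized measure δ/(2π). -/
theorem le_setLIntegral_poissonKernel {a b δ : ℝ} (hab : b - a ≤ Real.pi) {ζ : Circle}
    (hζ : ζ ∈ Circle.exp '' Ioo a b) (hδ : δ ∈ Ioc (0 : ℝ) 1) (hδab : δ ≤ (b - a) / 2) :
    ENNReal.ofReal (2 * Real.pi)⁻¹ ≤ ∫⁻ w in Circle.exp '' Ioo a b,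
      ENNReal.ofReal (poissonKernel 0 ((1 - δ : ℝ) * ζ) w) ∂normArcLength := by
  obtain ⟨θ, hθ, rfl⟩ := hζ
  have hπ := Real.pi_pos
  have hδ0 := hδ.1
  -- The subarc extends from θ towards the farther endpoint.
  obtain ⟨c, hc1, hc2, hc3, hc4⟩ : ∃ c, a ≤ c ∧ c + δ ≤ b ∧ c ≤ θ ∧ θ ≤ c + δ := by
    rcases le_total θ ((a + b) / 2) with h | h
    · exact ⟨θ, hθ.1.le, by linarith, le_rfl, by linarith [hδ.1]⟩
    · exact ⟨θ - δ, by linarith, by linarith [hθ.2], by linarith [hδ.1], by linarith⟩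
  have hmeas : normArcLength (Circle.exp '' Ioo c (c + δ)) =
      ENNReal.ofReal (2 * Real.pi)⁻¹ * ENNReal.ofReal δ := by
    rw [normArcLength_apply, arcLength_circleExp_image_Ioo (by linarith), add_sub_cancel_left]
  calc ENNReal.ofReal (2 * Real.pi)⁻¹ =
        ∫⁻ _ in Circle.exp '' Ioo c (c + δ), ENNReal.ofReal (1 / δ) ∂normArcLength := by
        rw [setLIntegral_const, hmeas, mul_left_comm, ← ENNReal.ofReal_mul (by positivity),
          one_div_mul_cancel hδ0.ne', ENNReal.ofReal_one, mul_one]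
    _ ≤ ∫⁻ w in Circle.exp '' Ioo c (c + δ),
        ENNReal.ofReal (poissonKernel 0 ((1 - δ : ℝ) * Circle.exp θ) w) ∂normArcLength := by
        refine setLIntegral_mono' (isOpen_circleExp_image_Ioo _ _).measurableSet ?_
        rintro _ ⟨t, ht, rfl⟩
        apply ENNReal.ofReal_le_ofReal
        have hd : dist (Circle.exp θ) (Circle.exp t) ≤ δ :=
          (dist_circleExp_le θ t).trans
            (abs_le.2 ⟨by linarith [ht.1, ht.2], by linarith [ht.1, ht.2]⟩)
        have hd2 : dist (Circle.exp θ) (Circle.exp t) ^ 2 ≤ δ ^ 2 :=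
          pow_le_pow_left₀ dist_nonneg hd 2
        have hρ : 0 ≤ 1 - δ := by linarith [hδ.2]
        rw [poissonKernel_radial, sub_sub_cancel, div_le_div_iff₀ hδ0 (by positivity), one_mul]
        nlinarith [mul_le_mul_of_nonneg_left hd2 hρ]
    _ ≤ _ := lintegral_mono_set (image_mono (Ioo_subset_Ioo hc1 hc2))

theorem isProbabilityMeasure_localPoisson {I : Set Circle} {ζ : Circle} {ρ : ℝ}
    (hρ : ρ ∈ Ico (0 : ℝ) 1) (hI : ENNReal.ofReal (2 * Real.pi)⁻¹ ≤
      ∫⁻ w in I, ENNReal.ofReal (poissonKernel 0 (ρ * ζ) w) ∂normArcLength) :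
    IsProbabilityMeasure (localPoisson I ζ ρ) := by
  constructor
  rw [localPoisson, Measure.smul_apply, withDensity_apply _ MeasurableSet.univ,
    Measure.restrict_univ, smul_eq_mul]
  refine ENNReal.inv_mul_cancel ?_ ?_
  · exact ((ENNReal.ofReal_pos.2 (by positivity)).trans_le hI).ne'
  · refine ((setLIntegral_le_lintegral _ _).trans_lt ?_).ne
    rw [lintegral_poissonKernel ζ hρ]
    exact ENNReal.one_lt_top

theorem inv_setLIntegral_poissonKernel_le {I : Set Circle} {ζ : Circle} {ρ : ℝ}
    (hI : ENNReal.ofReal (2 * Real.pi)⁻¹ ≤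
      ∫⁻ w in I, ENNReal.ofReal (poissonKernel 0 (ρ * ζ) w) ∂normArcLength) :
    (∫⁻ w in I, ENNReal.ofReal (poissonKernel 0 (ρ * ζ) w) ∂normArcLength)⁻¹ ≤ 8 := by
  refine (ENNReal.inv_le_inv.2 hI).trans ?_
  rw [← ENNReal.ofReal_inv_of_pos (by positivity), inv_inv,
    show (8 : ℝ≥0∞) = ENNReal.ofReal 8 by norm_num]
  exact ENNReal.ofReal_le_ofReal (by linarith [Real.pi_le_four])

theorem localPoisson_le_localCauchy {I : Set Circle} {ζ : Circle} {ρ : ℝ}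
    (hρ : ρ ∈ Ico (1 / 2 : ℝ) 1) (hI : ENNReal.ofReal (2 * Real.pi)⁻¹ ≤
      ∫⁻ w in I, ENNReal.ofReal (poissonKernel 0 (ρ * ζ) w) ∂normArcLength) :
    localPoisson I ζ ρ ≤ (32 : ℝ≥0∞) • localCauchy I ζ (1 - ρ) := by
  have h1 : (normArcLength.restrict I).withDensity
      (fun w => ENNReal.ofReal (poissonKernel 0 (ρ * ζ) w)) ≤
      (4 : ℝ≥0∞) • localCauchy I ζ (1 - ρ) := by
    rw [localCauchy, ← withDensity_smul _ (measurable_cauchyKernel_dist ζ (by linarith [hρ.2]))]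
    refine withDensity_mono (Eventually.of_forall fun w => ?_)
    rw [Pi.smul_apply, smul_eq_mul, show (4 : ℝ≥0∞) = ENNReal.ofReal 4 by norm_num,
      ← ENNReal.ofReal_mul (by norm_num)]
    exact ENNReal.ofReal_le_ofReal (poissonKernel_le_cauchyKernel ζ w hρ)
  -- The 8 bounds the normalizing factor, by 2π ≤ 8, and the 4 compares the two kernels.
  rw [localPoisson, show (32 : ℝ≥0∞) = 8 * 4 by norm_num, mul_smul]
  intro s
  exact mul_le_mul' (inv_setLIntegral_poissonKernel_le hI) (h1 s)

theorem localCauchy_div_four_le (I : Set Circle) (ζ : Circle) {δ : ℝ} (hδ : 0 < δ) :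
    localCauchy I ζ (δ / 4) ≤ (4 : ℝ≥0∞) • localCauchy I ζ δ := by
  rw [localCauchy, localCauchy, ← withDensity_smul _ (measurable_cauchyKernel_dist ζ hδ)]
  refine withDensity_mono (Eventually.of_forall fun w => ?_)
  rw [Pi.smul_apply, smul_eq_mul, show (4 : ℝ≥0∞) = ENNReal.ofReal 4 by norm_num,
    ← ENNReal.ofReal_mul (by norm_num)]
  apply ENNReal.ofReal_le_ofReal
  rw [cauchyKernel, cauchyKernel, ← mul_div_assoc, div_le_div_iff₀ (by positivity) (by positivity)]
  have := mul_nonneg hδ.le (sq_nonneg (dist ζ w))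
  nlinarith

theorem localCauchy_le_normArcLength (I : Set Circle) (ζ : Circle) {δ : ℝ} (hδ : 0 < δ) :
    localCauchy I ζ δ ≤ ENNReal.ofReal (1 / δ) • normArcLength := by
  calc localCauchy I ζ δ ≤
        (normArcLength.restrict I).withDensity fun _ => ENNReal.ofReal (1 / δ) := by
        refine withDensity_mono (Eventually.of_forall fun w => ENNReal.ofReal_le_ofReal ?_)
        rw [cauchyKernel, div_le_div_iff₀ (by positivity) hδ]
        nlinarith [sq_nonneg (dist ζ w)]
    _ = ENNReal.ofReal (1 / δ) • normArcLength.restrict I := withDensity_const _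
    _ ≤ _ := by
        intro s
        exact mul_le_mul' le_rfl (Measure.restrict_le_self s)

/-- Chords within the arc are at most its length, so at a scale comparable to that length the kernel
is bounded below by a multiple of the reciprocal length. -/
theorem uniform_le_localCauchy {a b : ℝ} (hab : a < b) (hπ : b - a ≤ Real.pi) {ζ : Circle}
    (hζ : ζ ∈ Circle.exp '' Ioo a b) :
    (normArcLength (Circle.exp '' Ioo a b))⁻¹ • normArcLength.restrict (Circle.exp '' Ioo a b) ≤
      (128 : ℝ≥0∞) • localCauchy (Circle.exp '' Ioo a b) ζ ((b - a) / 8) := by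
  have hlen : 0 < b - a := sub_pos.2 hab
  have hδ : 0 < (b - a) / 8 := by positivity
  rw [← withDensity_const, localCauchy,
    ← withDensity_smul _ (measurable_cauchyKernel_dist ζ hδ)]
  refine withDensity_mono ?_
  refine (ae_restrict_mem (isOpen_circleExp_image_Ioo _ _).measurableSet).mono fun w hw => ?_
  obtain ⟨s, hs, rfl⟩ := hζ
  obtain ⟨t, ht, rfl⟩ := hw
  have hd : dist (Circle.exp s) (Circle.exp t) ≤ b - a :=
    (dist_circleExp_le s t).trans (abs_le.2 ⟨by linarith [hs.1, ht.2], by linarith [hs.2, ht.1]⟩)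
  have hd2 : dist (Circle.exp s) (Circle.exp t) ^ 2 ≤ (b - a) ^ 2 :=
    pow_le_pow_left₀ dist_nonneg hd 2
  rw [Pi.smul_apply, smul_eq_mul, normArcLength_apply,
    arcLength_circleExp_image_Ioo (by linarith [Real.pi_pos]),
    ← ENNReal.ofReal_mul (by positivity), ← ENNReal.ofReal_inv_of_pos (by positivity),
    show (128 : ℝ≥0∞) = ENNReal.ofReal 128 by norm_num, ← ENNReal.ofReal_mul (by norm_num)]
  apply ENNReal.ofReal_le_ofReal
  rw [cauchyKernel, mul_inv, inv_inv, ← mul_div_assoc, ← div_eq_mul_inv,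
    div_le_div_iff₀ hlen (by positivity)]
  nlinarith [Real.pi_le_four, Real.pi_pos, sq_nonneg (b - a)]

/-- The full Poisson integral tends to 0 by hypothesis. As I is open, its complement stays at
positive distance from ζ, where the kernel is O(1 - ρ). -/
theorem setIntegral_poissonKernel_mul_tendsto_zero {f : ℂ → ℂ} {F : Circle → ℂ}
    (hFi : Integrable F normArcLength)
    (hf : ∀ w ∈ Metric.ball (0 : ℂ) 1,
      f w = ∫ ξ : Circle, (poissonKernel 0 w ξ : ℂ) * F ξ ∂normArcLength)
    {I : Set Circle} (hI : IsOpen I) {ζ : Circle} (hζ : ζ ∈ I) (hlim : HasRadialLimit f ζ 0) :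
    Tendsto (fun ρ : ℝ => ∫ ξ in I, (poissonKernel 0 (ρ * ζ) ξ : ℂ) * F ξ ∂normArcLength)
      (𝓝[<] 1) (𝓝 0) := by
  obtain ⟨h, hh, hball⟩ := Metric.isOpen_iff.1 hI ζ hζ
  have hev : ∀ᶠ ρ : ℝ in 𝓝[<] 1, ρ ∈ Ico (1 / 2 : ℝ) 1 := Ico_mem_nhdsLT (by norm_num)
  have htail : Tendsto
      (fun ρ : ℝ => ∫ ξ in Iᶜ, (poissonKernel 0 (ρ * ζ) ξ : ℂ) * F ξ ∂normArcLength)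
      (𝓝[<] 1) (𝓝 0) := by
    have hbound : Tendsto (fun ρ : ℝ => 4 * ((1 - ρ) / h ^ 2) * ∫ ξ, ‖F ξ‖ ∂normArcLength)
        (𝓝[<] 1) (𝓝 0) := by
      have : Tendsto (fun ρ : ℝ => 4 * ((1 - ρ) / h ^ 2) * ∫ ξ, ‖F ξ‖ ∂normArcLength)
          (𝓝 1) (𝓝 (4 * ((1 - 1) / h ^ 2) * ∫ ξ, ‖F ξ‖ ∂normArcLength)) :=
        Continuous.tendsto (by fun_prop) 1
      simp only [sub_self, zero_div, mul_zero, zero_mul] at this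
      exact this.mono_left nhdsWithin_le_nhds
    refine squeeze_zero_norm' ?_ hbound
    filter_upwards [hev] with ρ hρ
    have hρ0 : ρ ∈ Ico (0 : ℝ) 1 := ⟨by linarith [hρ.1], hρ.2⟩
    calc _ ≤ ∫ ξ in Iᶜ, 4 * ((1 - ρ) / h ^ 2) * ‖F ξ‖ ∂normArcLength := by
          refine norm_integral_le_of_norm_le (hFi.norm.const_mul _).integrableOn ?_
          refine (ae_restrict_mem hI.measurableSet.compl).mono fun ξ hξ => ?_
          rw [norm_mul, Complex.norm_real, Real.norm_eq_abs,
            abs_of_nonneg (poissonKernel_radial_nonneg ζ ξ hρ0)]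
          gcongr
          refine (poissonKernel_le_cauchyKernel ζ ξ hρ).trans ?_
          gcongr
          refine cauchyKernel_le_div_sq (by linarith [hρ.2]) hh ?_
          by_contra hlt
          exact hξ (hball (by rw [Metric.mem_ball']; exact not_le.1 hlt))
      _ ≤ ∫ ξ, 4 * ((1 - ρ) / h ^ 2) * ‖F ξ‖ ∂normArcLength := by
          refine setIntegral_le_integral (hFi.norm.const_mul _) (Eventually.of_forall fun ξ => ?_)
          have : 0 ≤ 1 - ρ := by linarith [hρ.2]
          change 0 ≤ 4 * ((1 - ρ) / h ^ 2) * ‖F ξ‖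
          positivity
      _ = _ := integral_const_mul _ _
  have hdiff := Tendsto.sub (show Tendsto (fun ρ : ℝ => f (ρ * ζ)) (𝓝[<] 1) (𝓝 0) from hlim) htail
  rw [sub_zero] at hdiff
  refine hdiff.congr' ?_
  filter_upwards [hev] with ρ hρ
  have hw := radial_mem_ball ζ (ρ := ρ) ⟨by linarith [hρ.1], hρ.2⟩
  have hPC : Continuous fun ξ : Circle => (poissonKernel 0 (ρ * ζ) ξ : ℂ) :=
    Complex.continuous_ofReal.comp (continuous_poissonKernel_circle hw)
  obtain ⟨B, hB⟩ := isCompact_univ.exists_bound_of_continuousOn hPC.continuousOn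
  have hint : Integrable (fun ξ : Circle => (poissonKernel 0 (ρ * ζ) ξ : ℂ) * F ξ)
      normArcLength :=
    hFi.bdd_mul hPC.aestronglyMeasurable (Eventually.of_forall fun ξ => hB ξ (mem_univ _))
  rw [hf _ hw, sub_eq_iff_eq_add, integral_add_compl hI.measurableSet hint]

theorem enorm_integral_localPoisson_le {I : Set Circle} {ζ : Circle} {ρ : ℝ}
    (hρ : ρ ∈ Ico (0 : ℝ) 1) (hI : ENNReal.ofReal (2 * Real.pi)⁻¹ ≤
      ∫⁻ w in I, ENNReal.ofReal (poissonKernel 0 (ρ * ζ) w) ∂normArcLength) (F : Circle → ℂ) :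
    ‖∫ ξ, F ξ ∂localPoisson I ζ ρ‖ₑ ≤
      8 * ‖∫ ξ in I, (poissonKernel 0 (ρ * ζ) ξ : ℂ) * F ξ ∂normArcLength‖ₑ := by
  have hle := inv_setLIntegral_poissonKernel_le hI
  have hne := (hle.trans_lt (by norm_num : (8 : ℝ≥0∞) < ∞)).ne
  have h1 : ∫ ξ, F ξ ∂(normArcLength.restrict I).withDensity
      (fun w => ENNReal.ofReal (poissonKernel 0 (ρ * ζ) w)) =
      ∫ ξ in I, (poissonKernel 0 (ρ * ζ) ξ : ℂ) * F ξ ∂normArcLength := by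
    rw [integral_withDensity_eq_integral_toReal_smul (measurable_poissonKernel_radial ζ hρ)
      (Eventually.of_forall fun w => ENNReal.ofReal_lt_top)]
    refine integral_congr_ae (Eventually.of_forall fun w => ?_)
    simp only [ENNReal.toReal_ofReal (poissonKernel_radial_nonneg ζ w hρ), Complex.real_smul]
  rw [localPoisson, integral_smul_measure, h1, enorm_smul]
  gcongr
  rw [Real.enorm_eq_ofReal ENNReal.toReal_nonneg, ENNReal.ofReal_toReal hne]
  exact hle

/-- If the Poisson integral `f` of `F` has radial limit `0` at a point `ζ` of an arc `I`, then the mean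
of `‖F‖` over `I` is bounded by the potential at `ζ` of the square root of the energy density. -/
theorem average_le_potential_energyDensity {β : ℝ} (hβ : 0 < β) (hβ1 : β ≤ 1) {a b : ℝ}
    (hab : a < b) (hπ : b - a ≤ Real.pi) {f : ℂ → ℂ} {F : Circle → ℂ} (hF : Measurable F)
    (hFi : Integrable F normArcLength)
    (hf : ∀ w ∈ Metric.ball (0 : ℂ) 1,
      f w = ∫ ξ : Circle, (poissonKernel 0 w ξ : ℂ) * F ξ ∂normArcLength)
    {ζ : Circle} (hζ : ζ ∈ Circle.exp '' Ioo a b) (hlim : HasRadialLimit f ζ 0) :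
    ⨍⁻ w in Circle.exp '' Ioo a b, ‖F w‖ₑ ∂normArcLength ≤
      2 * 128 ^ 2 * 16 * ∫⁻ z in Circle.exp '' Ioo a b,
        circleKernel (1 - β / 2) (ζ * z⁻¹) *
          energyDensity β (Circle.exp '' Ioo a b) F z ^ (1 / 2 : ℝ) ∂normArcLength := by
  set I := Circle.exp '' Ioo a b with hIdef
  have hIo : IsOpen I := isOpen_circleExp_image_Ioo a b
  -- As b - a ≤ π ≤ 4, this makes δ ≤ 1/2, so every radius below is at least 1/2, where the upper
  -- kernel comparison holds.
  set δ : ℝ := (b - a) / 8 with hδdef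
  have hlen : 0 < b - a := sub_pos.2 hab
  have hδ0 : 0 < δ := by positivity
  have hδ2 : δ ≤ 1 / 2 := by linarith [Real.pi_le_four]
  have hδj (j : ℕ) : 0 < δ / 4 ^ j ∧ δ / 4 ^ j ≤ δ :=
    ⟨by positivity, div_le_self hδ0.le (one_le_pow₀ (by norm_num))⟩
  let ρ : ℕ → ℝ := fun j => 1 - δ / 4 ^ j
  have hρ (j : ℕ) : ρ j ∈ Ico (1 / 2 : ℝ) 1 :=
    ⟨by linarith [hδj j, show ρ j = 1 - δ / 4 ^ j from rfl],
      by linarith [hδj j, show ρ j = 1 - δ / 4 ^ j from rfl]⟩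
  have hρ0 (j : ℕ) : ρ j ∈ Ico (0 : ℝ) 1 := ⟨by linarith [(hρ j).1], (hρ j).2⟩
  have hN (j : ℕ) : ENNReal.ofReal (2 * Real.pi)⁻¹ ≤
      ∫⁻ w in I, ENNReal.ofReal (poissonKernel 0 (ρ j * ζ) w) ∂normArcLength :=
    le_setLIntegral_poissonKernel hπ hζ ⟨(hδj j).1, by linarith [(hδj j).2]⟩
      (by linarith [(hδj j).2])
  have hprob (j : ℕ) : IsProbabilityMeasure (localPoisson I ζ (ρ j)) :=
    isProbabilityMeasure_localPoisson (hρ0 j) (hN j)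
  have h32 (j : ℕ) : localPoisson I ζ (ρ j) ≤ (32 : ℝ≥0∞) • localCauchy I ζ (δ / 4 ^ j) := by
    simpa [ρ] using localPoisson_le_localCauchy (hρ j) (hN j)
  have h0 (j : ℕ) : localPoisson I ζ (ρ j) ≤ (128 : ℝ≥0∞) • localCauchy I ζ (δ / 4 ^ j) :=
    (h32 j).trans fun s => mul_le_mul' (by norm_num) le_rfl
  -- Consecutive measures must be dominated by the same comparison measure; moving up one scale
  -- costs a further factor 4, hence 128 = 32 · 4.
  have h1 (j : ℕ) : localPoisson I ζ (ρ (j + 1)) ≤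
      (128 : ℝ≥0∞) • localCauchy I ζ (δ / 4 ^ j) := by
    refine (h32 (j + 1)).trans ?_
    rw [show (128 : ℝ≥0∞) = 32 * 4 by norm_num, mul_smul, pow_succ, ← div_div]
    intro s
    exact mul_le_mul' le_rfl (localCauchy_div_four_le I ζ (hδj j).1 s)
  have hFj (j : ℕ) : Integrable F (localPoisson I ζ (ρ j)) := by
    have hle : localPoisson I ζ (ρ j) ≤
        ((128 : ℝ≥0∞) * ENNReal.ofReal (1 / (δ / 4 ^ j))) • normArcLength := by
      refine (h0 j).trans ?_
      rw [mul_smul]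
      intro s
      exact mul_le_mul' le_rfl (localCauchy_le_normArcLength I ζ (hδj j).1 s)
    exact (hFi.smul_measure (ENNReal.mul_ne_top (by norm_num) ENNReal.ofReal_ne_top)).mono_measure
      hle
  have hmI : normArcLength I ≠ 0 := by
    rw [normArcLength_apply, hIdef, arcLength_circleExp_image_Ioo (by linarith [Real.pi_pos])]
    exact (ENNReal.mul_pos (ENNReal.ofReal_pos.2 (by positivity)).ne'
      (ENNReal.ofReal_pos.2 hlen).ne').ne'
  have hprobI : IsProbabilityMeasure ((normArcLength I)⁻¹ • normArcLength.restrict I) := by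
    constructor
    rw [Measure.smul_apply, Measure.restrict_apply_univ, smul_eq_mul]
    exact ENNReal.inv_mul_cancel hmI (measure_ne_top _ _)
  have hρlim : Tendsto ρ atTop (𝓝[<] 1) := by
    refine tendsto_nhdsWithin_iff.2 ⟨?_, Eventually.of_forall fun j => (hρ j).2⟩
    have : Tendsto (fun j : ℕ => 1 - δ * (4⁻¹ : ℝ) ^ j) atTop (𝓝 (1 - δ * 0)) :=
      ((tendsto_pow_atTop_nhds_zero_of_lt_one (by norm_num) (by norm_num)).const_mul δ).const_sub 1
    simpa [ρ, div_eq_mul_inv] using this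
  have hmean : Tendsto (fun j => ∫ x, F x ∂localPoisson I ζ (ρ j)) atTop (𝓝 0) := by
    have hset := (setIntegral_poissonKernel_mul_tendsto_zero hFi hf hIo hζ hlim).comp hρlim
    have hset' := ENNReal.Tendsto.const_mul (a := 8)
      ((continuous_enorm.tendsto (0 : ℂ)).comp hset) (Or.inr (by norm_num))
    rw [enorm_zero, mul_zero] at hset'
    rw [tendsto_iff_edist_tendsto_0]
    refine tendsto_of_tendsto_of_tendsto_of_le_of_le tendsto_const_nhds hset'
      (fun _ => zero_le) fun j => ?_
    simpa [edist_zero_right] using enorm_integral_localPoisson_le (hρ0 j) (hN j) F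
  have hmain := lintegral_enorm_le_tsum_oscillation
    (ν := (normArcLength I)⁻¹ • normArcLength.restrict I)
    (κ := fun j => localCauchy I ζ (δ / 4 ^ j)) (K := 128) (by norm_num) hFj
    (by simpa using uniform_le_localCauchy hab hπ hζ) h0 h1 hmean
  rw [laverage_eq', Measure.restrict_apply_univ]
  refine hmain.trans ?_
  rw [mul_assoc _ 16]
  gcongr
  exact tsum_oscillation_localCauchy_le hβ hβ1 hF ζ ⟨hδ0, by linarith⟩

/-! ### Capacity and conclusion -/

theorem arcLength_eq_smul : arcLength = ENNReal.ofReal (2 * Real.pi) • normArcLength := by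
  rw [normArcLength, smul_smul, ← ENNReal.ofReal_mul (by positivity),
    mul_inv_cancel₀ (by positivity), ENNReal.ofReal_one, one_smul]

theorem setLAverage_arcLength (I : Set Circle) (g : Circle → ℝ≥0∞) :
    ⨍⁻ w in I, g w ∂arcLength = ⨍⁻ w in I, g w ∂normArcLength := by
  rw [setLAverage_eq, setLAverage_eq, arcLength_eq_smul, Measure.restrict_smul,
    lintegral_smul_measure, Measure.smul_apply, smul_eq_mul, smul_eq_mul]
  exact ENNReal.mul_div_mul_left _ _ (ENNReal.ofReal_pos.2 Real.two_pi_pos).ne'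
    ENNReal.ofReal_ne_top

/-- An interval of angles longer than 2π would give an arc of full measure. -/
theorem IsOpenArc.exists_short {I : Set Circle} (hI : IsOpenArc I)
    (hlt : arcLength I < ENNReal.ofReal (2 * Real.pi)) :
    ∃ a b : ℝ, a < b ∧ b - a ≤ 2 * Real.pi ∧ I = Circle.exp '' Ioo a b := by
  obtain ⟨a, b, hab, rfl⟩ := hI
  refine ⟨a, b, hab, ?_, rfl⟩
  by_contra! h
  refine hlt.not_ge ?_
  calc ENNReal.ofReal (2 * Real.pi) = arcLength (Circle.exp '' Ioo a (a + 2 * Real.pi)) := by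
        rw [arcLength_circleExp_image_Ioo (by linarith), add_sub_cancel_left]
    _ ≤ _ := measure_mono (image_mono (Ioo_subset_Ioo_right (by linarith)))

theorem dirichletIntegral_congr {α : ℝ} {I J : Set Circle} {u v : Circle → ℂ}
    (h : u =ᵐ[normArcLength] v) : dirichletIntegral α I J u = dirichletIntegral α I J v := by
  refine lintegral_congr_ae ?_
  filter_upwards [ae_restrict_of_ae h] with z hz
  refine lintegral_congr_ae ?_
  filter_upwards [ae_restrict_of_ae h] with w hw
  rw [hz, hw]

theorem dirichletIntegral_mono_set {α : ℝ} {I I' J J' : Set Circle} (hI : I ⊆ I') (hJ : J ⊆ J')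
    (u : Circle → ℂ) : dirichletIntegral α I J u ≤ dirichletIntegral α I' J' u :=
  (lintegral_mono fun _ => lintegral_mono_set hJ).trans (lintegral_mono_set hI)

/-- Chords in the arc are at most its length, so lowering the exponent from 1 + α to 1 + β costs at
most that length to the power α - β. -/
theorem dirichletIntegral_le_rpow_mul {α β : ℝ} (hβα : β ≤ α) {a b : ℝ} (hab : a < b)
    (hπ : b - a ≤ 2 * Real.pi) (u : Circle → ℂ) :
    dirichletIntegral β (Circle.exp '' Ioo a b) (Circle.exp '' Ioo a b) u ≤
      arcLength (Circle.exp '' Ioo a b) ^ (α - β) *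
        dirichletIntegral α (Circle.exp '' Ioo a b) (Circle.exp '' Ioo a b) u := by
  have hlen : 0 < b - a := sub_pos.2 hab
  have hI := (isOpen_circleExp_image_Ioo a b).measurableSet
  rw [arcLength_circleExp_image_Ioo hπ, ENNReal.ofReal_rpow_of_pos hlen, dirichletIntegral,
    dirichletIntegral, ← lintegral_const_mul' _ _ ENNReal.ofReal_ne_top]
  refine setLIntegral_mono' hI ?_
  rintro _ ⟨s, hs, rfl⟩
  rw [← lintegral_const_mul' _ _ ENNReal.ofReal_ne_top]
  refine setLIntegral_mono' hI ?_
  rintro _ ⟨t, ht, rfl⟩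
  rw [← ENNReal.ofReal_mul (by positivity), norm_coe_sub_eq_dist]
  apply ENNReal.ofReal_le_ofReal
  have hd : dist (Circle.exp s) (Circle.exp t) ≤ b - a :=
    (dist_circleExp_le s t).trans (abs_le.2 ⟨by linarith [hs.1, ht.2], by linarith [hs.2, ht.1]⟩)
  rcases eq_or_ne (Circle.exp s) (Circle.exp t) with h | h
  · simp [h]
  have hd0 : 0 < dist (Circle.exp s) (Circle.exp t) := dist_pos.2 h
  rw [mul_div_assoc', div_le_div_iff₀ (Real.rpow_pos_of_pos hd0 _) (Real.rpow_pos_of_pos hd0 _),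
    show 1 + α = (1 + β) + (α - β) by ring, Real.rpow_add hd0]
  have := Real.rpow_le_rpow hd0.le hd (sub_nonneg.2 hβα)
  calc _ = dist (Circle.exp s) (Circle.exp t) ^ (α - β) * ‖u (Circle.exp s) - u (Circle.exp t)‖ ^ 2 *
        dist (Circle.exp s) (Circle.exp t) ^ (1 + β) := by ring
    _ ≤ _ := by gcongr

theorem circlePotential_const_mul (s : ℝ) (r : ℝ≥0) (g : Circle → ℝ≥0) (ζ : Circle) :
    circlePotential s (fun ξ => r * g ξ) ζ = r * circlePotential s g ζ := by
  rw [circlePotential, circlePotential, ← lintegral_const_mul' _ _ ENNReal.coe_ne_top]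
  refine lintegral_congr fun ξ => ?_
  rw [ENNReal.coe_mul, mul_left_comm]

/-- A lower bound for a potential on `E` yields an upper bound for the capacity of `E`. -/
theorem sq_mul_ltwoCapacity_le {β : ℝ} {E : Set Circle} {m C : ℝ≥0∞} (hm : m ≠ ∞) (hC : C ≠ ∞)
    {g : Circle → ℝ≥0} (hg : Measurable g)
    (h : ∀ ζ ∈ E, m ≤ C * circlePotential (1 - β / 2) g ζ) :
    m ^ 2 * ltwoCapacity β E ≤ C ^ 2 * ∫⁻ ξ, (g ξ : ℝ≥0∞) ^ 2 ∂normArcLength := by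
  rcases eq_or_ne m 0 with rfl | hm0
  · simp
  lift m to ℝ≥0 using hm
  lift C to ℝ≥0 using hC
  have hm0' : m ≠ 0 := by exact_mod_cast hm0
  have hcap : ltwoCapacity β E ≤
      ∫⁻ ξ, ((C / m * g ξ : ℝ≥0) : ℝ≥0∞) ^ 2 ∂normArcLength := by
    refine iInf_le_of_le (fun ξ => C / m * g ξ) (iInf_le_of_le (hg.const_mul _)
      (iInf_le_of_le (fun ζ hζ => ?_) le_rfl))
    rw [circlePotential_const_mul, ENNReal.coe_div hm0', ENNReal.mul_comm_div, ← mul_div_assoc,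
      ENNReal.le_div_iff_mul_le (Or.inl hm0) (Or.inl ENNReal.coe_ne_top), one_mul]
    exact h ζ hζ
  calc _ ≤ (m : ℝ≥0∞) ^ 2 * ∫⁻ ξ, ((C / m * g ξ : ℝ≥0) : ℝ≥0∞) ^ 2 ∂normArcLength := by gcongr
    _ = _ := by
      rw [← lintegral_const_mul' _ _ (by simp), ← lintegral_const_mul' _ _ (by simp)]
      refine lintegral_congr fun ξ => ?_
      norm_cast
      field_simp

theorem sq_average_mul_ltwoCapacity_le {β : ℝ} (hβ : 0 < β) (hβ1 : β ≤ 1) {a b : ℝ}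
    (hab : a < b) (hπ : b - a ≤ Real.pi) {f : ℂ → ℂ} {F : Circle → ℂ} (hF : Measurable F)
    (hFi : Integrable F normArcLength)
    (hf : ∀ w ∈ Metric.ball (0 : ℂ) 1,
      f w = ∫ ξ : Circle, (poissonKernel 0 w ξ : ℂ) * F ξ ∂normArcLength)
    (hfin : dirichletIntegral β (Circle.exp '' Ioo a b) (Circle.exp '' Ioo a b) F ≠ ∞)
    {E : Set Circle} (hE : ∀ ζ ∈ E, HasRadialLimit f ζ 0) :
    (⨍⁻ w in Circle.exp '' Ioo a b, ‖F w‖ₑ ∂normArcLength) ^ 2 *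
        ltwoCapacity β (E ∩ Circle.exp '' Ioo a b) ≤
      (2 * 128 ^ 2 * 16) ^ 2 *
        dirichletIntegral β (Circle.exp '' Ioo a b) (Circle.exp '' Ioo a b) F := by
  set I := Circle.exp '' Ioo a b
  have hI : MeasurableSet I := (isOpen_circleExp_image_Ioo a b).measurableSet
  have hG : Measurable (energyDensity β I F) := measurable_energyDensity hF
  have hD : ∫⁻ z in I, energyDensity β I F z ∂normArcLength = dirichletIntegral β I I F := rfl
  -- Where the density is infinite `toNNReal` gives 0. Finite energy makes this a null subset of I,
  -- invisible to the potential and to the L² norm.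
  let g : Circle → ℝ≥0 := I.indicator fun z => (energyDensity β I F z ^ (1 / 2 : ℝ)).toNNReal
  have hg : Measurable g := (hG.pow_const _).ennreal_toNNReal.indicator hI
  have hgI : ∀ᵐ z ∂normArcLength.restrict I,
      (g z : ℝ≥0∞) = energyDensity β I F z ^ (1 / 2 : ℝ) := by
    filter_upwards [ae_lt_top hG (hD.trans_ne hfin), ae_restrict_mem hI] with z hz hzI
    rw [show g z = _ from indicator_of_mem hzI _, ENNReal.coe_toNNReal]
    exact ENNReal.rpow_ne_top_of_nonneg (by norm_num) hz.ne
  have hpot (ζ : Circle) : ∫⁻ z in I, circleKernel (1 - β / 2) (ζ * z⁻¹) *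
      energyDensity β I F z ^ (1 / 2 : ℝ) ∂normArcLength ≤ circlePotential (1 - β / 2) g ζ := by
    refine le_trans (lintegral_congr_ae ?_).le (setLIntegral_le_lintegral I _)
    filter_upwards [hgI] with z hz
    rw [hz]
  have hnorm : ∫⁻ z, (g z : ℝ≥0∞) ^ 2 ∂normArcLength = dirichletIntegral β I I F := by
    rw [← setLIntegral_eq_of_support_subset (s := I), ← hD]
    · refine lintegral_congr_ae ?_
      filter_upwards [hgI] with z hz
      rw [hz, ← ENNReal.rpow_two, ← ENNReal.rpow_mul]
      norm_num
    · intro z hz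
      by_contra hzI
      simp [g, hzI] at hz
  rw [← hnorm]
  refine sq_mul_ltwoCapacity_le ?_ (by norm_num) hg fun ζ hζ => ?_
  · exact (setLAverage_lt_top hFi.integrableOn.2.ne).ne
  · refine (average_le_potential_energyDensity hβ hβ1 hab hπ hF hFi hf hζ.2 (hE ζ hζ.1)).trans ?_
    gcongr
    exact hpot ζ

theorem theorem2p2 (β γ : ℝ) (hβ : 0 < β) (hβ_le : β ≤ 1) (hγ : 0 < γ) (hγ_lt : γ < 1) :
    ∃ c : ℝ, 0 < c ∧
      ∀ (α : ℝ), β ≤ α → α ≤ 1 →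
      ∀ (f : ℂ → ℂ), MemDirichlet α f →
      ∀ (E : Set Circle), (∀ ζ ∈ E, HasRadialLimit f ζ 0) →
      ∀ (I : Set Circle), IsOpenArc I → arcLength I ≤ ENNReal.ofReal (γ * Real.pi) →
        (⨍⁻ ξ in I, ‖boundaryValue f ξ‖ₑ ∂arcLength) ^ 2 * ltwoCapacity β (E ∩ I) ≤
          ENNReal.ofReal c * arcLength I ^ (α - β) * dirichletIntegral α I I (boundaryValue f) := by
  -- Inside the square, 2 · 128² comes from the telescoping with comparison constant 128, and 16
  -- from summing the profiles to the Riesz kernel.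
  refine ⟨(2 * 128 ^ 2 * 16) ^ 2, by norm_num, ?_⟩
  intro α hβα _ f hf E hE I hI hIγ
  have hπ := Real.pi_pos
  obtain ⟨a, b, hab, hlen, rfl⟩ := hI.exists_short
    (hIγ.trans_lt ((ENNReal.ofReal_lt_ofReal_iff (by positivity)).2 (by nlinarith)))
  have hlen' : b - a ≤ Real.pi := by
    rw [arcLength_circleExp_image_Ioo hlen, ENNReal.ofReal_le_ofReal_iff (by positivity)] at hIγ
    nlinarith
  obtain ⟨F, hF, hF2, hrep⟩ := hf.memHardyTwo.exists_poisson_representation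
  have hFi : Integrable F normArcLength := hF2.integrable (by norm_num)
  have hFae : boundaryValue f =ᵐ[normArcLength] F := by
    filter_upwards [ae_hasRadialLimit_of_poisson_representation hF hFi hrep] with z hz
    exact hz.limUnder_eq
  have havg : ⨍⁻ w in Circle.exp '' Ioo a b, ‖boundaryValue f w‖ₑ ∂arcLength =
      ⨍⁻ w in Circle.exp '' Ioo a b, ‖F w‖ₑ ∂normArcLength := by
    rw [setLAverage_arcLength]
    refine laverage_congr ?_
    filter_upwards [ae_restrict_of_ae hFae] with w hw
    rw [hw]
  have hDα := dirichletIntegral_le_rpow_mul hβα hab hlen F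
  -- Finite energy of order α on the whole circle passes to order β on the arc; this is what makes
  -- the test function finite almost everywhere on the arc.
  have hfin : dirichletIntegral β (Circle.exp '' Ioo a b) (Circle.exp '' Ioo a b) F ≠ ∞ := by
    refine (hDα.trans_lt (ENNReal.mul_lt_top ?_ ?_)).ne
    · rw [arcLength_circleExp_image_Ioo hlen]
      exact ENNReal.rpow_lt_top_of_nonneg (sub_nonneg.2 hβα) ENNReal.ofReal_ne_top
    · rw [← dirichletIntegral_congr hFae]
      exact (dirichletIntegral_mono_set (subset_univ _) (subset_univ _) _).trans_lt
        hf.energy_lt_top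
  rw [havg, dirichletIntegral_congr hFae, mul_assoc]
  refine (sq_average_mul_ltwoCapacity_le hβ hβ_le hab hlen' hF.measurable hFi hrep hfin hE).trans ?_
  refine mul_le_mul' (le_of_eq ?_) hDα
  norm_num
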